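/- There is a universal constant $C>0$ such that the following holds for every dimension $d$. Points of $(\mathbb{R}^d,\|\cdot\|_2)$ arrive online in pairs. A randomized online algorithm maintains, after the arrival of the $n$-th pair, a perfect matching $M_n$ of $x_1,\dots,x_{2n}$ that depends only on $x_1,\dots,x_{2n}$ and on the random bits of the algorithm; the distribution of the random bits does not depend on the input, and neither the later points nor their number or aspect ratio are known to the algorithm. The weight $w(M)$ of a matching $M$ is the sum of the Euclidean lengths of its edges, $\mathrm{OPT}_n$ is the minimum weight of a perfect matching of $x_1,\dots,x_{2n}$, the recourse of step $n$ is $|M_{n-1}\setminus M_n|$, the number of edges deleted when the $n$-th pair arrives (with $M_0=\emptyset$), and $$\Phi_n=\frac{\max_{i,j\le 2n}\|x_i-x_j\|_2}{\min_{i\ne j\le 2n}\|x_i-x_j\|_2}$$ is the aspect ratio of $x_1,\dots,x_{2n}$. 1. There is a randomized online algorithm such that, for every input sequence fixed in advance (oblivious adversary) and every $n\ge 1$ for which $x_1,\dots,x_{2n}$ are pairwise distinct, $$\mathbb{E}[w(M_n)]\le C\sqrt{d}\,(1+\log\Phi_n)\cdot \mathrm{OPT}_n ,$$ and, for every outcome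 of the random bits, the recourse of step $n$ is at most $C(1+\log\Phi_n)$. 2. Alternatively, there is a randomized online algorithm with the same bound on $\mathbb{E}[w(M_n)]$ under the same conditions, and whose recourse in step $n$ is, for every outcome of the random bits, at most $C\log^3 n$. -/

import Mathlib

open MeasureTheory

noncomputable section

/-- `M` is the edge set of a perfect matching of the first `2 * n` points of a sequence. A point is
named by its index `0, 1, …, 2 * n - 1`, and an edge is an unordered pair of distinct indices. -/
def IsPerfectMatching (n : ℕ) (M : Finset (Sym2 ℕ)) : Prop :=
  (∀ e ∈ M, ¬ e.IsDiag ∧ ∀ v ∈ e, v < 2 * n) ∧ ∀ v < 2 * n, ∃! e, e ∈ M ∧ v ∈ e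

/-- The length of an edge between two points of the sequence `x`. -/
def edgeLength {X : Type*} [MetricSpace X] (x : ℕ → X) : Sym2 ℕ → ℝ :=
  Sym2.lift ⟨fun i j => dist (x i) (x j), fun i j => dist_comm (x i) (x j)⟩

/-- The weight of a set of edges: the sum of the edge lengths. -/
def weight {X : Type*} [MetricSpace X] (x : ℕ → X) (M : Finset (Sym2 ℕ)) : ℝ :=
  ∑ e ∈ M, edgeLength x e

/-- The minimum weight of a perfect matching of the first `2 * n` points of `x`. -/
def optWeight {X : Type*} [MetricSpace X] (x : ℕ → X) (n : ℕ) : ℝ :=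
  sInf (weight x '' {M | IsPerfectMatching n M})

/-- The aspect ratio of the first `m` points of `x`: the largest distance divided by the smallest
distance between two points with different indices (meaningful for `m ≥ 2` distinct points). -/
def aspectRatio {X : Type*} [MetricSpace X] (x : ℕ → X) (m : ℕ) : ℝ :=
  (⨆ p : Fin m × Fin m, dist (x p.1) (x p.2)) /
    (⨅ p : {p : Fin m × Fin m // p.1 ≠ p.2}, dist (x p.1.1) (x p.1.2))

/-- A randomized online algorithm (with recourse) for perfect matchings of points of `X` that arrive
in pairs. All random bits are contained in `ω`, drawn from a probability space that does not depend
on the input. After the arrival of the `n`-th pair the output is a function of `ω` and of the first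
`2 * n` points alone: neither the later points nor their number are known. -/
structure RandomizedOnlineMatching (X : Type*) where
  /-- The sample space of the random bits. -/
  Ω : Type
  /-- The events. -/
  [mΩ : MeasurableSpace Ω]
  /-- The distribution of the random bits. -/
  μ : Measure Ω
  [isProb : IsProbabilityMeasure μ]
  /-- The edges held after the arrival of the `n`-th pair. -/
  output : Ω → (n : ℕ) → (Fin (2 * n) → X) → Finset (Sym2 ℕ)
  isPerfectMatching : ∀ ω n p, IsPerfectMatching n (output ω n p)
  measurableSet_output : ∀ n p M, MeasurableSet {ω | output ω n p = M}

namespace RandomizedOnlineMatching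

variable {X : Type*} (A : RandomizedOnlineMatching X)

/-- The matching held after the first `n` pairs of the sequence `x` have arrived. -/
def matching (ω : A.Ω) (x : ℕ → X) (n : ℕ) : Finset (Sym2 ℕ) :=
  A.output ω n fun k => x k

/-- The expected weight of the matching held after the first `n` pairs of the sequence `x`, which is
fixed in advance (oblivious adversary). -/
def expectedWeight [MetricSpace X] (x : ℕ → X) (n : ℕ) : ℝ :=
  letI := A.mΩ
  ∫ ω, weight x (A.matching ω x n) ∂A.μ

/-- The recourse of step `n ≥ 1`: the number of edges deleted when the `n`-th pair arrives. -/
def recourse (ω : A.Ω) (x : ℕ → X) (n : ℕ) : ℕ :=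
  (A.matching ω x (n - 1) \ A.matching ω x n).card

end RandomizedOnlineMatching

end

/-! The points are put into a random hierarchy: clusters of level k have diameter at most 4·2^k, and
x, y lie in different ones with probability O(√d·‖x−y‖/2^k) (`bitsMeasure_not_together_le`). The
matching is kept balanced: among clusters with a common parent at most one is crossed by two or more
edges, and that one is not much smaller than its siblings.

Balance controls the weight. An edge joining two siblings of level k is the only edge that crosses
one of them. A cluster crossed once has odd size, so every perfect matching crosses it; hence there
are at most twice as many such edges as there are edges of an optimal matching split at level k
(`card_filter_le`). Each has length O(2^k), so in expectation every level costs O(√d)·OPT, and only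
O(1+log Φ) levels lie between the smallest and the largest distance.

Balance is cheap to restore. Replacing two edges that leave a cluster by one edge inside and one
outside lowers its crossing number by 2 and, by laminarity, raises that of no other cluster
(`exists_uncross`). A new pair, inserted as an edge, can spoil balance only at levels where a new
point has a sibling cluster of at least a third of the size of its own. There it suffices to uncross
at most three siblings once each, for each new point (`exists_balanced_succ`). The number of such
levels is O(1+log Φ), and also O(log n), since the cluster of the point grows by a factor 4/3 at
each (`pow_card_largeSibling_le`). So one algorithm gives both parts, with O(log n) recourse in the
second.

A plain random grid would lose a factor d instead of √d. Here each seed is a randomly shifted unit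
grid with a random threshold, compared with a product of squared sines that vanishes on the cell
walls; a point belongs to the first seed that captures it. Cells have diameter at most √d and
separate x from y with probability O(‖x−y‖), free of the dimension (`seedsMeasure_not_sameCell_le`).
As the final scale is unknown, a ball of random radius around the first point is made a single cell
at every level, so that all points are together above the scale of the data. -/

/-! ### Crossing numbers of matchings -/

namespace IsPerfectMatching

variable {n : ℕ} {M : Finset (Sym2 ℕ)}

theorem eq_of_mem (h : IsPerfectMatching n M) {e f : Sym2 ℕ} (he : e ∈ M) (hf : f ∈ M) {v : ℕ}
    (hve : v ∈ e) (hvf : v ∈ f) : e = f :=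
  (h.2 v ((h.1 e he).2 v hve)).unique ⟨he, hve⟩ ⟨hf, hvf⟩

theorem ne (h : IsPerfectMatching n M) {a b : ℕ} (he : s(a, b) ∈ M) : a ≠ b := fun hab =>
  (h.1 _ he).1 (by simpa using hab)

theorem lt_left (h : IsPerfectMatching n M) {a b : ℕ} (he : s(a, b) ∈ M) : a < 2 * n :=
  (h.1 _ he).2 a (by simp)

theorem lt_right (h : IsPerfectMatching n M) {a b : ℕ} (he : s(a, b) ∈ M) : b < 2 * n :=
  (h.1 _ he).2 b (by simp)

end IsPerfectMatching

/-- The number (`0` or `1`) of times that an edge crosses the boundary of the set `D`. -/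
noncomputable def crosses (D : Set ℕ) : Sym2 ℕ → ℕ := by
  classical
  exact Sym2.lift ⟨fun a b => if (a ∈ D ↔ b ∈ D) then 0 else 1, fun a b => by simp only [iff_comm]⟩

open Classical in
theorem crosses_mk (D : Set ℕ) (a b : ℕ) :
    crosses D s(a, b) = if (a ∈ D ↔ b ∈ D) then 0 else 1 := rfl

theorem crosses_le_one (D : Set ℕ) (e : Sym2 ℕ) : crosses D e ≤ 1 := by
  induction e using Sym2.ind with
  | _ a b => rw [crosses_mk]; split_ifs <;> omega

/-- The number of edges of `M` with exactly one end in `D`. -/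
noncomputable def crossing (M : Finset (Sym2 ℕ)) (D : Set ℕ) : ℕ := ∑ e ∈ M, crosses D e

/-- Two sets are laminar if they are nested or disjoint. -/
def Laminar (B D : Set ℕ) : Prop := D ⊆ B ∨ B ⊆ D ∨ Disjoint B D

/-- Laminarity puts both `b`'s or both `u`'s on one side of `D`, so at most one new edge crosses
`D`. If it does, its ends are on different sides, and one of them belongs to an old edge that
crosses `D`. -/
theorem crosses_uncross_le {B D : Set ℕ} (hBD : Laminar B D) {b₁ b₂ u₁ u₂ : ℕ}
    (hb₁ : b₁ ∈ B) (hb₂ : b₂ ∈ B) (hu₁ : u₁ ∉ B) (hu₂ : u₂ ∉ B) :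
    crosses D s(b₁, b₂) + crosses D s(u₁, u₂) ≤ crosses D s(b₁, u₁) + crosses D s(b₂, u₂) := by
  simp only [crosses_mk]
  rcases hBD with h | h | h
  · have h1 : u₁ ∉ D := fun hu => hu₁ (h hu)
    have h2 : u₂ ∉ D := fun hu => hu₂ (h hu)
    by_cases h3 : b₁ ∈ D <;> by_cases h4 : b₂ ∈ D <;> simp [h1, h2, h3, h4]
  · have h1 : b₁ ∈ D := h hb₁
    have h2 : b₂ ∈ D := h hb₂
    by_cases h3 : u₁ ∈ D <;> by_cases h4 : u₂ ∈ D <;> simp [h1, h2, h3, h4]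
  · have h1 : b₁ ∉ D := Set.disjoint_left.1 h hb₁
    have h2 : b₂ ∉ D := Set.disjoint_left.1 h hb₂
    by_cases h3 : u₁ ∈ D <;> by_cases h4 : u₂ ∈ D <;> simp [h1, h2, h3, h4]

theorem exists_of_crosses_ne_zero {B : Set ℕ} {e : Sym2 ℕ} (h : crosses B e ≠ 0) :
    ∃ b u, e = s(b, u) ∧ b ∈ B ∧ u ∉ B := by
  induction e using Sym2.ind with
  | _ a b =>
    rw [crosses_mk] at h
    by_cases h1 : a ∈ B <;> by_cases h2 : b ∈ B <;> simp [h1, h2] at h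
    · exact ⟨a, b, rfl, h1, h2⟩
    · exact ⟨b, a, Sym2.eq_swap, h2, h1⟩

/-- Replacing the edges `b₁u₁`, `b₂u₂` of a perfect matching by `b₁b₂`, `u₁u₂`. -/
theorem IsPerfectMatching.swap {n : ℕ} {M : Finset (Sym2 ℕ)} (hM : IsPerfectMatching n M)
    {b₁ b₂ u₁ u₂ : ℕ} (h₁ : s(b₁, u₁) ∈ M) (h₂ : s(b₂, u₂) ∈ M) (hb : b₁ ≠ b₂) (hu : u₁ ≠ u₂)
    (hbu : b₁ ≠ u₂) (hub : u₁ ≠ b₂) :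
    IsPerfectMatching n
        (insert s(b₁, b₂) (insert s(u₁, u₂) ((M.erase s(b₁, u₁)).erase s(b₂, u₂)))) ∧
      s(b₁, b₂) ∉ M ∧ s(u₁, u₂) ∉ M ∧ s(b₁, b₂) ≠ s(u₁, u₂) := by
  have hbu₁ := hM.ne h₁
  have hbu₂ := hM.ne h₂
  have lb₁ := hM.lt_left h₁
  have lu₁ := hM.lt_right h₁
  have lb₂ := hM.lt_left h₂
  have lu₂ := hM.lt_right h₂
  have key₁ : ∀ f ∈ M, ∀ v, v ∈ f → v = b₁ ∨ v = u₁ → f = s(b₁, u₁) := fun f hf v hv h =>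
    hM.eq_of_mem hf h₁ hv (by simpa using h)
  have key₂ : ∀ f ∈ M, ∀ v, v ∈ f → v = b₂ ∨ v = u₂ → f = s(b₂, u₂) := fun f hf v hv h =>
    hM.eq_of_mem hf h₂ hv (by simpa using h)
  refine ⟨⟨?_, ?_⟩, ?_, ?_, ?_⟩
  · intro e he
    simp only [Finset.mem_insert, Finset.mem_erase] at he
    rcases he with rfl | rfl | ⟨-, -, he⟩
    · refine ⟨by simpa using hb, fun v hv => ?_⟩
      rcases Sym2.mem_iff.1 hv with rfl | rfl <;> assumption
    · refine ⟨by simpa using hu, fun v hv => ?_⟩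
      rcases Sym2.mem_iff.1 hv with rfl | rfl <;> assumption
    · exact hM.1 e he
  · intro v hv
    obtain ⟨e, ⟨he, hve⟩, huniq⟩ := hM.2 v hv
    by_cases hvb : v = b₁ ∨ v = b₂
    · refine ⟨s(b₁, b₂), ⟨by simp, by simpa using hvb⟩, ?_⟩
      rintro f ⟨hf, hvf⟩
      simp only [Finset.mem_insert, Finset.mem_erase] at hf
      rcases hf with rfl | rfl | ⟨hf2, hf1, hf⟩
      · rfl
      · rw [Sym2.mem_iff] at hvf
        grind
      · rcases hvb with h | h
        · exact absurd (key₁ f hf v hvf (Or.inl h)) hf1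
        · exact absurd (key₂ f hf v hvf (Or.inl h)) hf2
    · by_cases hvu : v = u₁ ∨ v = u₂
      · refine ⟨s(u₁, u₂), ⟨by simp, by simpa using hvu⟩, ?_⟩
        rintro f ⟨hf, hvf⟩
        simp only [Finset.mem_insert, Finset.mem_erase] at hf
        rcases hf with rfl | rfl | ⟨hf2, hf1, hf⟩
        · rw [Sym2.mem_iff] at hvf
          exact absurd hvf hvb
        · rfl
        · rcases hvu with h | h
          · exact absurd (key₁ f hf v hvf (Or.inr h)) hf1
          · exact absurd (key₂ f hf v hvf (Or.inr h)) hf2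
      · refine ⟨e, ⟨?_, hve⟩, ?_⟩
        · simp only [Finset.mem_insert, Finset.mem_erase]
          refine Or.inr (Or.inr ⟨?_, ?_, he⟩)
          · rintro rfl
            rw [Sym2.mem_iff] at hve
            tauto
          · rintro rfl
            rw [Sym2.mem_iff] at hve
            tauto
        · rintro f ⟨hf, hvf⟩
          simp only [Finset.mem_insert, Finset.mem_erase] at hf
          rcases hf with rfl | rfl | ⟨hf2, hf1, hf⟩
          · rw [Sym2.mem_iff] at hvf
            exact absurd hvf hvb
          · rw [Sym2.mem_iff] at hvf
            exact absurd hvf hvu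
          · exact huniq f ⟨hf, hvf⟩
  · intro h
    have := key₁ _ h b₁ (by simp) (Or.inl rfl)
    rw [Sym2.eq_iff] at this
    grind
  · intro h
    have := key₁ _ h u₁ (by simp) (Or.inr rfl)
    rw [Sym2.eq_iff] at this
    grind
  · intro h
    rw [Sym2.eq_iff] at h
    grind

/-- Uncrossing a set `B`. -/
theorem IsPerfectMatching.exists_uncross {n : ℕ} {M : Finset (Sym2 ℕ)} (hM : IsPerfectMatching n M)
    {B : Set ℕ} (hB : 2 ≤ crossing M B) :
    ∃ M', IsPerfectMatching n M' ∧ crossing M' B + 2 ≤ crossing M B ∧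
      (∀ D, Laminar B D → crossing M' D ≤ crossing M D) ∧
      ∀ M₀ : Finset (Sym2 ℕ), (M₀ \ M').card ≤ (M₀ \ M).card + 2 := by
  have hcard : 1 < (M.filter fun e => crosses B e ≠ 0).card := by
    refine lt_of_lt_of_le (by omega : 1 < crossing M B) ?_
    rw [crossing, ← Finset.sum_filter_ne_zero, Finset.card_eq_sum_ones]
    exact Finset.sum_le_sum fun e _ => crosses_le_one B e
  obtain ⟨e₁, he₁, e₂, he₂, hne⟩ := Finset.one_lt_card.1 hcard
  rw [Finset.mem_filter] at he₁ he₂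
  obtain ⟨b₁, u₁, rfl, hb₁, hu₁⟩ := exists_of_crosses_ne_zero he₁.2
  obtain ⟨b₂, u₂, rfl, hb₂, hu₂⟩ := exists_of_crosses_ne_zero he₂.2
  have hb : b₁ ≠ b₂ := by
    rintro rfl
    exact hne (hM.eq_of_mem he₁.1 he₂.1 (v := b₁) (by simp) (by simp))
  have hu : u₁ ≠ u₂ := by
    rintro rfl
    exact hne (hM.eq_of_mem he₁.1 he₂.1 (v := u₁) (by simp) (by simp))
  have hbu : b₁ ≠ u₂ := fun h => hu₂ (h ▸ hb₁)
  have hub : u₁ ≠ b₂ := fun h => hu₁ (h ▸ hb₂)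
  obtain ⟨hM', hn₁, hn₂, hn₃⟩ := hM.swap he₁.1 he₂.1 hb hu hbu hub
  set K := (M.erase s(b₁, u₁)).erase s(b₂, u₂) with hK
  have hKM : K ⊆ M := (Finset.erase_subset _ _).trans (Finset.erase_subset _ _)
  have h1 : ∀ D, crossing (insert s(b₁, b₂) (insert s(u₁, u₂) K)) D =
      crosses D s(b₁, b₂) + crosses D s(u₁, u₂) + crossing K D := by
    intro D
    rw [crossing, Finset.sum_insert, Finset.sum_insert, crossing, add_assoc]
    · exact fun h => hn₂ (hKM h)
    · rw [Finset.mem_insert, not_or]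
      exact ⟨hn₃, fun h => hn₁ (hKM h)⟩
  have h2 : ∀ D, crossing M D = crosses D s(b₁, u₁) + crosses D s(b₂, u₂) + crossing K D := by
    intro D
    rw [crossing, ← Finset.add_sum_erase M _ he₁.1, ← Finset.add_sum_erase (M.erase _) _
      (Finset.mem_erase.2 ⟨hne.symm, he₂.1⟩), crossing, add_assoc]
  refine ⟨_, hM', ?_, ?_, ?_⟩
  · rw [h1, h2]
    simp only [crosses_mk, hb₁, hb₂, hu₁, hu₂]
    simp
    omega
  · intro D hD
    rw [h1, h2]
    have := crosses_uncross_le hD hb₁ hb₂ hu₁ hu₂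
    omega
  · intro M₀
    have hsub : M₀ \ insert s(b₁, b₂) (insert s(u₁, u₂) K) ⊆
        insert s(b₁, u₁) (insert s(b₂, u₂) (M₀ \ M)) := by
      intro e he
      simp only [hK, Finset.mem_sdiff, Finset.mem_insert, Finset.mem_erase] at he ⊢
      tauto
    refine (Finset.card_le_card hsub).trans ((Finset.card_insert_le _ _).trans ?_)
    exact Nat.succ_le_succ (Finset.card_insert_le _ _)

/-- Uncrossing once each member of a laminar family. -/
theorem IsPerfectMatching.exists_uncross_family {n : ℕ} {M : Finset (Sym2 ℕ)}
    (hM : IsPerfectMatching n M) (F : Finset (Set ℕ)) (hF : ∀ B ∈ F, ∀ D ∈ F, Laminar B D) :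
    ∃ M', IsPerfectMatching n M' ∧
      (∀ B ∈ F, crossing M' B ≤ 1 ∨ crossing M' B + 2 ≤ crossing M B) ∧
      (∀ D, (∀ B ∈ F, Laminar B D) → crossing M' D ≤ crossing M D) ∧
      (M \ M').card ≤ 2 * F.card := by
  classical
  induction F using Finset.induction_on with
  | empty => exact ⟨M, hM, by simp, by simp, by simp⟩
  | insert B F hBF ih =>
    obtain ⟨M₁, hM₁, h1, h2, h3⟩ := ih fun B hB D hD =>
      hF B (Finset.mem_insert_of_mem hB) D (Finset.mem_insert_of_mem hD)
    have hB : ∀ D ∈ F, Laminar D B := fun D hD =>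
      hF D (Finset.mem_insert_of_mem hD) B (Finset.mem_insert_self _ _)
    rw [Finset.card_insert_of_notMem hBF]
    rcases Nat.lt_or_ge (crossing M₁ B) 2 with hlt | hge
    · refine ⟨M₁, hM₁, ?_, ?_, by omega⟩
      · intro D hD
        rcases Finset.mem_insert.1 hD with rfl | hD
        · left; omega
        · exact h1 D hD
      · intro D hD
        exact h2 D fun B' hB' => hD B' (Finset.mem_insert_of_mem hB')
    -- Uncrossing `B` raises no crossing number of the members treated before, so their reductions
    -- survive.
    · obtain ⟨M', hM', g1, g2, g3⟩ := hM₁.exists_uncross hge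
      refine ⟨M', hM', ?_, ?_, ?_⟩
      · intro D hD
        rcases Finset.mem_insert.1 hD with rfl | hD'
        · right
          have := h2 D hB
          omega
        · have := g2 D (hF B (Finset.mem_insert_self _ _) D hD)
          rcases h1 D hD' with h | h
          · left; omega
          · right; omega
      · intro D hD
        exact (g2 D (hD B (Finset.mem_insert_self _ _))).trans
          (h2 D fun B' hB' => hD B' (Finset.mem_insert_of_mem hB'))
      · have := g3 M
        omega

/-! ### Insertion of a pair, parity -/

theorem IsPerfectMatching.insert_pair {n : ℕ} {M : Finset (Sym2 ℕ)} (hM : IsPerfectMatching n M) :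
    IsPerfectMatching (n + 1) (insert s(2 * n, 2 * n + 1) M) := by
  refine ⟨?_, ?_⟩
  · intro e he
    rcases Finset.mem_insert.1 he with rfl | he
    · refine ⟨by simp, fun v hv => ?_⟩
      rcases Sym2.mem_iff.1 hv with rfl | rfl <;> omega
    · exact ⟨(hM.1 e he).1, fun v hv => ((hM.1 e he).2 v hv).trans (by omega)⟩
  · intro v hv
    by_cases h : v < 2 * n
    · obtain ⟨e, ⟨he, hve⟩, hu⟩ := hM.2 v h
      refine ⟨e, ⟨Finset.mem_insert_of_mem he, hve⟩, ?_⟩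
      rintro f ⟨hf, hvf⟩
      rcases Finset.mem_insert.1 hf with rfl | hf
      · rcases Sym2.mem_iff.1 hvf with h' | h' <;> omega
      · exact hu f ⟨hf, hvf⟩
    · refine ⟨_, ⟨Finset.mem_insert_self _ _, ?_⟩, ?_⟩
      · rw [Sym2.mem_iff]; omega
      · rintro f ⟨hf, hvf⟩
        rcases Finset.mem_insert.1 hf with rfl | hf
        · rfl
        · exact absurd ((hM.1 f hf).2 v hvf) h

theorem IsPerfectMatching.crossing_insert_pair {n : ℕ} {M : Finset (Sym2 ℕ)}
    (hM : IsPerfectMatching n M) (D : Set ℕ) :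
    crossing (insert s(2 * n, 2 * n + 1) M) D =
      crosses D s(2 * n, 2 * n + 1) + crossing M D := by
  rw [crossing, Finset.sum_insert, crossing]
  intro h
  have := hM.lt_left h
  omega

theorem isPerfectMatching_zero : IsPerfectMatching 0 ∅ := ⟨by simp, by simp⟩

/-- In a perfect matching the size of a set and its crossing number have the same parity. -/
theorem IsPerfectMatching.exists_card_eq {n : ℕ} {M : Finset (Sym2 ℕ)} (hM : IsPerfectMatching n M)
    (B : Finset ℕ) (hB : ∀ v ∈ B, v < 2 * n) : ∃ r, B.card = crossing M B + 2 * r := by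
  classical
  have h1 : B.card = ∑ e ∈ M, (B.filter (· ∈ e)).card := by
    simp_rw [Finset.card_filter]
    rw [Finset.sum_comm, Finset.card_eq_sum_ones]
    refine Finset.sum_congr rfl fun v hv => ?_
    rw [← Finset.card_filter]
    symm
    rw [Finset.card_eq_one]
    obtain ⟨e, he, hu⟩ := hM.2 v (hB v hv)
    refine ⟨e, ?_⟩
    ext f
    rw [Finset.mem_filter, Finset.mem_singleton]
    exact ⟨fun h => hu f h, fun h => h ▸ he⟩
  have h2 : ∀ e ∈ M, ∃ r, (B.filter (· ∈ e)).card = crosses B e + 2 * r := by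
    intro e he
    induction e using Sym2.ind with
    | _ a b =>
      have hab := hM.ne he
      have : B.filter (· ∈ s(a, b)) = B ∩ {a, b} := by
        ext v; simp
      rw [this, crosses_mk]
      by_cases ha : a ∈ B <;> by_cases hb : b ∈ B
      · exact ⟨1, by
          rw [Finset.inter_eq_right.2 (by simp [Finset.insert_subset_iff, ha, hb]),
            Finset.card_pair hab]; simp [ha, hb]⟩
      · exact ⟨0, by
          rw [Finset.inter_insert_of_mem ha, Finset.inter_singleton_of_notMem hb]; simp [ha, hb]⟩
      · exact ⟨0, by
          rw [Finset.inter_insert_of_notMem ha, Finset.inter_singleton_of_mem hb]; simp [ha, hb]⟩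
      · exact ⟨0, by
          rw [Finset.inter_insert_of_notMem ha, Finset.inter_singleton_of_notMem hb]
          simp [ha, hb]⟩
  choose! r hr using h2
  refine ⟨∑ e ∈ M, r e, ?_⟩
  rw [h1, Finset.sum_congr rfl hr, Finset.sum_add_distrib, ← Finset.mul_sum, crossing]

section

/-! ### Hierarchies of clusters -/

/-- A hierarchy of equivalence relations on the indices, coarser at higher levels. -/
structure IsHierarchy (R : ℤ → ℕ → ℕ → Prop) : Prop where
  equiv : ∀ k, Equivalence (R k)
  mono : ∀ {k l u v}, k ≤ l → R k u v → R l u v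

open Classical in
/-- The cluster of `u` at level `k` among the first `N` indices. -/
noncomputable def cluster (R : ℤ → ℕ → ℕ → Prop) (N : ℕ) (k : ℤ) (u : ℕ) : Finset ℕ :=
  (Finset.range N).filter fun z => R k z u

/-- Two clusters with the same parent are not both crossed twice, and a cluster that is
much smaller than a sibling is crossed at most once. -/
def IsBalancedMatching (R : ℤ → ℕ → ℕ → Prop) (N : ℕ) (M : Finset (Sym2 ℕ)) : Prop :=
  ∀ k u v, u < N → v < N → R (k + 1) u v → ¬ R k u v →
    crossing M (cluster R N k u) ≤ 1 ∨
      (crossing M (cluster R N k v) ≤ 1 ∧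
        crossing M (cluster R N k u) + (cluster R N k v).card ≤ 3 * (cluster R N k u).card)

/-- The index `z` has, at level `k`, a sibling cluster that is not much smaller than its own. -/
def HasLargeSibling (R : ℤ → ℕ → ℕ → Prop) (N z : ℕ) (k : ℤ) : Prop :=
  ∃ v < N, R (k + 1) v z ∧ ¬ R k v z ∧ (cluster R N k z).card ≤ 3 * (cluster R N k v).card

variable {R : ℤ → ℕ → ℕ → Prop}

theorem mem_cluster {N : ℕ} {k : ℤ} {u z : ℕ} : z ∈ cluster R N k u ↔ z < N ∧ R k z u := by
  simp [cluster]

theorem cluster_congr {R' : ℤ → ℕ → ℕ → Prop} {N : ℕ}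
    (h : ∀ k u v, u < N → v < N → (R k u v ↔ R' k u v)) (k : ℤ) {u : ℕ} (hu : u < N) :
    cluster R N k u = cluster R' N k u := by
  ext z
  rw [mem_cluster, mem_cluster]
  exact and_congr_right fun hz => h k z u hz hu

theorem isBalancedMatching_congr {R' : ℤ → ℕ → ℕ → Prop} {N : ℕ}
    (h : ∀ k u v, u < N → v < N → (R k u v ↔ R' k u v)) (M : Finset (Sym2 ℕ)) :
    IsBalancedMatching R N M ↔ IsBalancedMatching R' N M := by
  refine forall_congr' fun k => forall_congr' fun u => forall_congr' fun v => ?_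
  refine forall_congr' fun hu => forall_congr' fun hv => ?_
  rw [h _ u v hu hv, h _ u v hu hv, cluster_congr h k hu, cluster_congr h k hv]

theorem IsPerfectMatching.crossing_congr {n : ℕ} {M : Finset (Sym2 ℕ)}
    (hM : IsPerfectMatching n M) {B D : Set ℕ} (h : ∀ v < 2 * n, v ∈ B ↔ v ∈ D) :
    crossing M B = crossing M D := by
  refine Finset.sum_congr rfl fun e he => ?_
  induction e using Sym2.ind with
  | _ a b => rw [crosses_mk, crosses_mk, h a (hM.lt_left he), h b (hM.lt_right he)]

theorem IsPerfectMatching.crossing_cluster_succ {n : ℕ} {M : Finset (Sym2 ℕ)}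
    (hM : IsPerfectMatching n M) (k : ℤ) (u : ℕ) :
    crossing M (cluster R (2 * (n + 1)) k u) = crossing M (cluster R (2 * n) k u) := by
  refine hM.crossing_congr fun v hv => ?_
  simp only [Finset.mem_coe, mem_cluster]
  constructor
  · exact fun h => ⟨hv, h.2⟩
  · exact fun h => ⟨by omega, h.2⟩

open Classical in
theorem card_cluster_succ (n : ℕ) (k : ℤ) (u : ℕ) :
    (cluster R (2 * (n + 1)) k u).card = (cluster R (2 * n) k u).card +
      ((if R k (2 * n) u then 1 else 0) + (if R k (2 * n + 1) u then 1 else 0)) := by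
  rw [cluster, cluster, show 2 * (n + 1) = 2 * n + 1 + 1 by ring, Finset.range_add_one,
    Finset.range_add_one, Finset.filter_insert, Finset.filter_insert]
  have h1 : 2 * n ∉ (Finset.range (2 * n)).filter fun z => R k z u := by simp
  split_ifs with hq hp hp
  · rw [Finset.card_insert_of_notMem (by simp), Finset.card_insert_of_notMem h1]
  · rw [Finset.card_insert_of_notMem (by simp)]
  · rw [Finset.card_insert_of_notMem h1]
  · rfl

open Classical in
theorem crosses_cluster_succ (n : ℕ) (k : ℤ) (u : ℕ) :
    crosses (cluster R (2 * (n + 1)) k u) s(2 * n, 2 * n + 1) =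
      if (R k (2 * n) u ↔ R k (2 * n + 1) u) then 0 else 1 := by
  rw [crosses_mk]
  have hp : 2 * n ∈ (cluster R (2 * (n + 1)) k u : Set ℕ) ↔ R k (2 * n) u := by
    rw [Finset.mem_coe, mem_cluster]; exact and_iff_right (by omega)
  have hq : 2 * n + 1 ∈ (cluster R (2 * (n + 1)) k u : Set ℕ) ↔ R k (2 * n + 1) u := by
    rw [Finset.mem_coe, mem_cluster]; exact and_iff_right (by omega)
  simp only [hp, hq]

theorem IsPerfectMatching.crossing_le_card {n : ℕ} {M : Finset (Sym2 ℕ)}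
    (hM : IsPerfectMatching n M) (k : ℤ) (u : ℕ) :
    crossing M (cluster R (2 * n) k u) ≤ (cluster R (2 * n) k u).card := by
  obtain ⟨r, hr⟩ := hM.exists_card_eq (cluster R (2 * n) k u) fun v hv => (mem_cluster.1 hv).1
  omega

/-! ### Laminarity of clusters and restoring balance after an insertion. -/

namespace IsHierarchy

variable (hR : IsHierarchy R)
include hR

theorem cluster_eq {N : ℕ} {k : ℤ} {u v : ℕ} (h : R k u v) : cluster R N k u = cluster R N k v := by
  ext z
  rw [mem_cluster, mem_cluster]
  exact and_congr_right fun _ =>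
    ⟨fun hz => (hR.equiv k).trans hz h, fun hz => (hR.equiv k).trans hz ((hR.equiv k).symm h)⟩

theorem cluster_subset {N : ℕ} {k l : ℤ} (hkl : k ≤ l) (u : ℕ) :
    cluster R N k u ⊆ cluster R N l u := fun _ hz =>
  mem_cluster.2 ⟨(mem_cluster.1 hz).1, hR.mono hkl (mem_cluster.1 hz).2⟩

theorem laminar_of_le {N : ℕ} {k l : ℤ} (hkl : k ≤ l) (u v : ℕ) :
    (cluster R N k u : Set ℕ) ⊆ cluster R N l v ∨
      Disjoint (cluster R N k u : Set ℕ) (cluster R N l v) := by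
  by_cases h : R l u v
  · left
    rw [← hR.cluster_eq h]
    exact Finset.coe_subset.2 (hR.cluster_subset hkl u)
  · right
    rw [Finset.disjoint_coe, Finset.disjoint_left]
    intro z hz hz'
    rw [mem_cluster] at hz hz'
    exact h ((hR.equiv l).trans ((hR.equiv l).symm (hR.mono hkl hz.2)) hz'.2)

theorem laminar {N : ℕ} (k l : ℤ) (u v : ℕ) :
    Laminar (cluster R N k u : Set ℕ) (cluster R N l v) := by
  rcases le_total k l with h | h
  · exact Or.inr (hR.laminar_of_le h u v)
  · rcases hR.laminar_of_le (N := N) h v u with h' | h'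
    · exact Or.inl h'
    · exact Or.inr (Or.inr h'.symm)

/-- An empty cluster satisfies the alternative trivially, and a nonempty one has a representative
among the old indices. This covers new indices, whose clusters may contain no old point. -/
theorem balanced_of_any {n : ℕ} {M : Finset (Sym2 ℕ)} (hM : IsPerfectMatching n M)
    (hB : IsBalancedMatching R (2 * n) M) {k : ℤ} {u v : ℕ} (huv : R (k + 1) u v) (hn : ¬ R k u v) :
    crossing M (cluster R (2 * n) k u) ≤ 1 ∨
      (crossing M (cluster R (2 * n) k v) ≤ 1 ∧
        crossing M (cluster R (2 * n) k u) + (cluster R (2 * n) k v).card ≤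
          3 * (cluster R (2 * n) k u).card) := by
  have hu := hM.crossing_le_card (R := R) k u
  have hv := hM.crossing_le_card (R := R) k v
  rcases (cluster R (2 * n) k u).eq_empty_or_nonempty with h | ⟨u', hu'⟩
  · rw [h, Finset.card_empty] at hu
    left; rw [h]; omega
  rcases (cluster R (2 * n) k v).eq_empty_or_nonempty with h | ⟨v', hv'⟩
  · rw [h, Finset.card_empty] at hv
    right
    constructor
    · rw [h]; omega
    · rw [h, Finset.card_empty]; omega
  rw [mem_cluster] at hu' hv'
  rw [← hR.cluster_eq hu'.2, ← hR.cluster_eq hv'.2]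
  refine hB k u' v' hu'.1 hv'.1 ?_ fun h => hn ?_
  · exact (hR.equiv _).trans (hR.mono (by omega) hu'.2)
      ((hR.equiv _).trans huv ((hR.equiv _).symm (hR.mono (by omega) hv'.2)))
  · exact (hR.equiv _).trans ((hR.equiv _).symm hu'.2) ((hR.equiv _).trans h hv'.2)

/-- At most three clusters with the same parent are crossed twice after a pair is inserted. -/
theorem exists_multiply_crossed_siblings {n : ℕ} {M : Finset (Sym2 ℕ)}
    (hM : IsPerfectMatching n M) (hB : IsBalancedMatching R (2 * n) M) (k : ℤ) (z : ℕ) :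
    ∃ F : Finset (Set ℕ), F.card ≤ 3 ∧
      (∀ B ∈ F, ∃ u, B = cluster R (2 * (n + 1)) k u) ∧
      ∀ u, R (k + 1) u z →
        2 ≤ crossing (insert s(2 * n, 2 * n + 1) M) (cluster R (2 * (n + 1)) k u) →
        (cluster R (2 * (n + 1)) k u : Set ℕ) ∈ F := by
  classical
  by_cases hex : ∃ w, R (k + 1) w z ∧ 2 ≤ crossing M (cluster R (2 * n) k w)
  on_goal 1 => obtain ⟨w, hwz, hw⟩ := hex
  -- If no sibling was crossed twice before, the third cluster is irrelevant; the dummy index 0 lets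
  -- both cases share one argument.
  on_goal 2 => obtain ⟨w, hw⟩ : ∃ w : ℕ, w = w := ⟨0, rfl⟩
  all_goals
    refine ⟨{(cluster R (2 * (n + 1)) k (2 * n) : Set ℕ),
      (cluster R (2 * (n + 1)) k (2 * n + 1) : Set ℕ), (cluster R (2 * (n + 1)) k w : Set ℕ)},
      Finset.card_le_three, ?_, ?_⟩
    · intro B hB
      simp only [Finset.mem_insert, Finset.mem_singleton] at hB
      rcases hB with rfl | rfl | rfl <;> exact ⟨_, rfl⟩
    intro u huz hu
    simp only [Finset.mem_insert, Finset.mem_singleton]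
    rw [hM.crossing_insert_pair, crosses_cluster_succ, hM.crossing_cluster_succ] at hu
    by_cases hp : R k (2 * n) u
    · left; rw [hR.cluster_eq hp]
    by_cases hq : R k (2 * n + 1) u
    · right; left; rw [hR.cluster_eq hq]
    -- A cluster without new points keeps its old crossing number, and two different siblings cannot
    -- both have been crossed twice.
    right; right
    simp only [hp, hq, if_true] at hu
  · by_cases hwu : R k w u
    · rw [hR.cluster_eq hwu]
    exfalso
    have := hR.balanced_of_any hM hB ((hR.equiv _).trans hwz ((hR.equiv _).symm huz)) hwu
    omega
  · exact absurd ⟨u, huz, by omega⟩ hex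

/-- The matching can be kept balanced with few deletions when a pair is inserted. -/
theorem exists_balanced_succ {n : ℕ} {M : Finset (Sym2 ℕ)}
    (hM : IsPerfectMatching n M) (hB : IsBalancedMatching R (2 * n) M) (T : ℕ → Finset ℤ) (K : ℕ)
    (hT : ∀ z, 2 * n ≤ z → z < 2 * (n + 1) → ∀ k,
      HasLargeSibling R (2 * (n + 1)) z k → k ∈ T z) (hK : ∀ z, (T z).card ≤ K) :
    ∃ M', IsPerfectMatching (n + 1) M' ∧ IsBalancedMatching R (2 * (n + 1)) M' ∧
      (M \ M').card ≤ 12 * K := by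
  classical
  choose F hF₁ hF₂ hF₃ using hR.exists_multiply_crossed_siblings hM hB
  set M₁ := insert s(2 * n, 2 * n + 1) M with hM₁
  have hp₁ : IsPerfectMatching (n + 1) M₁ := hM.insert_pair
  -- The clusters to uncross: at most three per new point and level, with two deletions each. This
  -- gives 2·3·2 = 12 deletions per level.
  set G : ℕ → Finset (Set ℕ) := fun z => (T z).biUnion fun k => F k z with hG
  have hGcard : ∀ z, (G z).card ≤ K * 3 := fun z =>
    (Finset.card_biUnion_le_card_mul _ _ 3 fun k _ => hF₁ k z).trans
      (Nat.mul_le_mul_right 3 (hK z))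
  have hGcl : ∀ B ∈ G (2 * n) ∪ G (2 * n + 1), ∃ k u, B = cluster R (2 * (n + 1)) k u := by
    intro B hB
    simp only [hG, Finset.mem_union, Finset.mem_biUnion] at hB
    rcases hB with ⟨k, -, hB⟩ | ⟨k, -, hB⟩ <;> exact ⟨k, hF₂ _ _ B hB⟩
  obtain ⟨M', hM', h1, h2, h3⟩ := hp₁.exists_uncross_family (G (2 * n) ∪ G (2 * n + 1)) (by
    intro B hB D hD
    obtain ⟨k, u, rfl⟩ := hGcl B hB
    obtain ⟨l, v, rfl⟩ := hGcl D hD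
    exact hR.laminar k l u v)
  have h2' : ∀ k u, crossing M' (cluster R (2 * (n + 1)) k u) ≤
      crossing M₁ (cluster R (2 * (n + 1)) k u) := by
    intro k u
    refine h2 _ fun B hB => ?_
    obtain ⟨l, v, rfl⟩ := hGcl B hB
    exact hR.laminar l k v u
  refine ⟨M', hM', ?_, ?_⟩
  · intro k u v hu hv huv hn
    have hvu := (hR.equiv _).symm huv
    have hn' : ¬ R k v u := fun h => hn ((hR.equiv _).symm h)
    have o1 := hR.balanced_of_any hM hB huv hn
    have o2 := hR.balanced_of_any hM hB hvu hn'
    have cu : crossing M₁ (cluster R (2 * (n + 1)) k u) = _ := hM.crossing_insert_pair _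
    have cv : crossing M₁ (cluster R (2 * (n + 1)) k v) = _ := hM.crossing_insert_pair _
    rw [crosses_cluster_succ, hM.crossing_cluster_succ] at cu cv
    have su := card_cluster_succ (R := R) n k u
    have sv := card_cluster_succ (R := R) n k v
    have mu := h2' k u
    have mv := h2' k v
    have lu := hp₁.crossing_le_card (R := R) k u
    have lv := hp₁.crossing_le_card (R := R) k v
    have ep : ¬ (R k (2 * n) u ∧ R k (2 * n) v) := fun h =>
      hn ((hR.equiv k).trans ((hR.equiv k).symm h.1) h.2)
    have eq : ¬ (R k (2 * n + 1) u ∧ R k (2 * n + 1) v) := fun h =>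
      hn ((hR.equiv k).trans ((hR.equiv k).symm h.1) h.2)
    -- At a treated level every multiply crossed sibling loses 2 crossings. This outweighs what the
    -- pair adds to the crossing number of `u` and to the size of `v`, relative to three times the
    -- growth of `u`.
    by_cases hA : ∃ z, 2 * n ≤ z ∧ z < 2 * (n + 1) ∧ R (k + 1) u z ∧
        HasLargeSibling R (2 * (n + 1)) z k
    · obtain ⟨z, hz1, hz2, huz, hz⟩ := hA
      have hkT := hT z hz1 hz2 k hz
      have hmem : ∀ w, R (k + 1) w z → 2 ≤ crossing M₁ (cluster R (2 * (n + 1)) k w) →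
          (cluster R (2 * (n + 1)) k w : Set ℕ) ∈ G (2 * n) ∪ G (2 * n + 1) := by
        intro w hw hw2
        have hwF := hF₃ k z w hw hw2
        have hwG : (cluster R (2 * (n + 1)) k w : Set ℕ) ∈ G z :=
          Finset.mem_biUnion.2 ⟨k, hkT, hwF⟩
        rw [Finset.mem_union]
        obtain rfl | rfl : z = 2 * n ∨ z = 2 * n + 1 := by omega
        · exact Or.inl hwG
        · exact Or.inr hwG
      have red : ∀ w, R (k + 1) w z → crossing M' (cluster R (2 * (n + 1)) k w) ≤ 1 ∨
          crossing M' (cluster R (2 * (n + 1)) k w) + 2 ≤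
            crossing M₁ (cluster R (2 * (n + 1)) k w) := by
        intro w hw
        by_cases hw2 : 2 ≤ crossing M₁ (cluster R (2 * (n + 1)) k w)
        · exact h1 _ (hmem w hw hw2)
        · left
          have := h2' k w
          omega
      have ru := red u huz
      have rv := red v ((hR.equiv _).trans hvu huz)
      by_cases p1 : R k (2 * n) u <;> by_cases q1 : R k (2 * n + 1) u <;>
        by_cases p2 : R k (2 * n) v <;> by_cases q2 : R k (2 * n + 1) v <;>
        simp only [p1, q1, p2, q2, if_true, if_false, iff_true, iff_false, not_true_eq_false,
          not_false_eq_true, and_self] at cu cv su sv ep eq <;> omega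
    -- At an untreated level, whichever of the two clusters receives a new point is more than three
    -- times as large as the other. The old size inequality then left at most one crossing to the
    -- smaller cluster, and for the larger one the inequality follows from crossing number ≤ size.
    · have hsib : ∀ z, 2 * n ≤ z → z < 2 * (n + 1) → ∀ a b, b < 2 * (n + 1) → R (k + 1) u b →
          R (k + 1) a b → ¬ R k a b → R k z a →
          3 * (cluster R (2 * (n + 1)) k b).card < (cluster R (2 * (n + 1)) k a).card := by
        intro z hz1 hz2 a b hb hub hab hnab hza
        by_contra hcon
        push Not at hcon
        have hza' := hR.mono (by omega : k ≤ k + 1) hza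
        have hzb : R (k + 1) b z :=
          (hR.equiv _).trans ((hR.equiv _).symm hab) ((hR.equiv _).symm hza')
        refine hA ⟨z, hz1, hz2, (hR.equiv _).trans hub hzb, b, hb, hzb, fun h => hnab ?_, ?_⟩
        · exact (hR.equiv _).symm ((hR.equiv _).trans h hza)
        · rw [hR.cluster_eq hza]; exact hcon
      have su1 := fun z hz1 hz2 => hsib z hz1 hz2 u v hv huv huv hn
      have sv1 := fun z hz1 hz2 => hsib z hz1 hz2 v u hu ((hR.equiv _).refl u) hvu hn'
      have su1p := su1 (2 * n) le_rfl (by omega)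
      have su1q := su1 (2 * n + 1) (by omega) (by omega)
      have sv1p := sv1 (2 * n) le_rfl (by omega)
      have sv1q := sv1 (2 * n + 1) (by omega) (by omega)
      clear su1 sv1 hsib hA
      by_cases p1 : R k (2 * n) u <;> by_cases q1 : R k (2 * n + 1) u <;>
        by_cases p2 : R k (2 * n) v <;> by_cases q2 : R k (2 * n + 1) v <;>
        simp only [p1, q1, p2, q2, if_true, if_false, iff_true, iff_false, not_true_eq_false,
          not_false_eq_true, and_self, forall_const, IsEmpty.forall_iff] at cu cv su sv ep eq su1p su1q sv1p sv1q <;>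
        omega
  · have : (M \ M').card ≤ (M₁ \ M').card :=
      Finset.card_le_card (Finset.sdiff_subset_sdiff (Finset.subset_insert _ _) le_rfl)
    have h4 := (Finset.card_union_le (G (2 * n)) (G (2 * n + 1)))
    have := hGcard (2 * n)
    have := hGcard (2 * n + 1)
    omega

end IsHierarchy

end

section

/-! ### Weight and depth of balanced matchings -/

/-- The ends of the edge `e` lie in different clusters at level `k`. -/
def Splits (R : ℤ → ℕ → ℕ → Prop) (k : ℤ) (e : Sym2 ℕ) : Prop := ∃ a b, e = s(a, b) ∧ ¬ R k a b

variable {R : ℤ → ℕ → ℕ → Prop}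

namespace IsHierarchy

variable (hR : IsHierarchy R)
include hR

theorem splits_mk {k : ℤ} {a b : ℕ} : Splits R k s(a, b) ↔ ¬ R k a b := by
  constructor
  · rintro ⟨c, d, h, hn⟩ hab
    rcases Sym2.eq_iff.1 h with ⟨rfl, rfl⟩ | ⟨rfl, rfl⟩
    · exact hn hab
    · exact hn ((hR.equiv k).symm hab)
  · exact fun h => ⟨a, b, rfl, h⟩

/-- A large sibling has at least a third of the size of the cluster of `z` and is disjoint from it,
so passing to the parent multiplies the size by at least 4/3. -/
theorem pow_card_largeSibling_le {N z : ℕ} (hz : z < N) (F : Finset ℤ)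
    (hF : ∀ k ∈ F, HasLargeSibling R N z k) : 4 ^ F.card ≤ 3 ^ F.card * N := by
  have key : ∀ K : ℤ, (∀ k ∈ F, k < K) → 4 ^ F.card ≤ 3 ^ F.card * (cluster R N K z).card := by
    induction F using Finset.induction_on_max with
    | empty =>
      intro K _
      have : z ∈ cluster R N K z := mem_cluster.2 ⟨hz, (hR.equiv K).refl z⟩
      simpa using Finset.card_pos.2 ⟨z, this⟩
    | insert k F hk ih =>
      intro K hK
      have hkF : k ∉ F := fun h => lt_irrefl _ (hk k h)
      have h1 := ih (fun l hl => hF l (Finset.mem_insert_of_mem hl)) k hk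
      obtain ⟨v, hv, hvz, hnvz, hcard⟩ := hF k (Finset.mem_insert_self _ _)
      have hkK : k + 1 ≤ K := hK k (Finset.mem_insert_self _ _)
      have h2 : (cluster R N k z).card + (cluster R N k v).card ≤ (cluster R N K z).card := by
        rw [← Finset.card_union_of_disjoint]
        · refine Finset.card_le_card (Finset.union_subset (hR.cluster_subset (by omega) z) ?_)
          rw [← hR.cluster_eq (hR.mono hkK hvz)]
          exact hR.cluster_subset (by omega) v
        · rw [Finset.disjoint_left]
          intro w hw hw'
          rw [mem_cluster] at hw hw'
          exact hnvz ((hR.equiv k).trans ((hR.equiv k).symm hw'.2) hw.2)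
      rw [Finset.card_insert_of_notMem hkF, pow_succ, pow_succ]
      calc 4 ^ F.card * 4 ≤ 3 ^ F.card * (cluster R N k z).card * 4 := Nat.mul_le_mul_right 4 h1
        _ = 3 ^ F.card * ((cluster R N k z).card * 4) := by ring
        _ ≤ 3 ^ F.card * (3 * (cluster R N K z).card) := Nat.mul_le_mul_left _ (by omega)
        _ = 3 ^ F.card * 3 * (cluster R N K z).card := by ring
  obtain ⟨K, hK⟩ := F.exists_le
  refine (key (K + 1) fun k hk => by have := hK k hk; omega).trans (Nat.mul_le_mul_left _ ?_)
  have hsub : cluster R N (K + 1) z ⊆ Finset.range N := fun w hw =>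
    Finset.mem_range.2 (mem_cluster.1 hw).1
  simpa using Finset.card_le_card hsub

open Classical in
-- Clusters of one level are disjoint, so an edge crosses at most those of its two ends.
theorem sum_crosses_cluster_le {N : ℕ} (k : ℤ) {a b : ℕ} (ha : a < N) (hb : b < N)
    (C : Finset (Finset ℕ)) (hC : ∀ B ∈ C, ∃ u, B = cluster R N k u) :
    ∑ B ∈ C, crosses B s(a, b) ≤ if Splits R k s(a, b) then 2 else 0 := by
  have hmem : ∀ {c u : ℕ}, c < N → (c ∈ (cluster R N k u : Set ℕ) ↔ R k c u) := fun hc => by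
    rw [Finset.mem_coe, mem_cluster]; exact and_iff_right hc
  split_ifs with h
  · calc ∑ B ∈ C, crosses B s(a, b)
        ≤ ∑ B ∈ C, if B ∈ ({cluster R N k a, cluster R N k b} : Finset (Finset ℕ)) then 1 else 0 := by
          refine Finset.sum_le_sum fun B hB => ?_
          obtain ⟨u, rfl⟩ := hC B hB
          split_ifs with h'
          · exact crosses_le_one _ _
          · rw [crosses_mk, hmem ha, hmem hb]
            simp only [Finset.mem_insert, Finset.mem_singleton, not_or] at h'
            have h1 : ¬ R k a u := fun h => h'.1 (hR.cluster_eq h).symm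
            have h2 : ¬ R k b u := fun h => h'.2 (hR.cluster_eq h).symm
            simp [h1, h2]
      _ = (C ∩ {cluster R N k a, cluster R N k b}).card := by
          rw [← Finset.card_filter, Finset.filter_mem_eq_inter]
      _ ≤ 2 := (Finset.card_le_card Finset.inter_subset_right).trans Finset.card_le_two
  · rw [hR.splits_mk, not_not] at h
    refine (Finset.sum_eq_zero fun B hB => ?_).le
    obtain ⟨u, rfl⟩ := hC B hB
    rw [crosses_mk, hmem ha, hmem hb, if_pos]
    exact ⟨(hR.equiv k).trans ((hR.equiv k).symm h), (hR.equiv k).trans h⟩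

open Classical in
/-- A balanced matching has, at every level, at most twice as many edges joining sibling clusters
as any perfect matching has edges between different clusters. -/
theorem card_filter_le {n : ℕ} {M M' : Finset (Sym2 ℕ)} (hM : IsPerfectMatching n M)
    (hM' : IsPerfectMatching n M') (hB : IsBalancedMatching R (2 * n) M) (k : ℤ) :
    (M.filter fun e => Splits R k e ∧ ¬ Splits R (k + 1) e).card ≤
      2 * (M'.filter (Splits R k)).card := by
  -- Each edge to be counted crosses a member of `C`, which no second edge of `M` crosses. Members
  -- of `C` have odd size, so `M'` crosses them as well.
  set C := ((Finset.range (2 * n)).image (cluster R (2 * n) k)).filter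
    fun B : Finset ℕ => crossing M B = 1 with hC
  have hCcl : ∀ B ∈ C, ∃ u, B = cluster R (2 * n) k u := by
    intro B hB
    obtain ⟨u, -, rfl⟩ := Finset.mem_image.1 (Finset.mem_filter.1 hB).1
    exact ⟨u, rfl⟩
  have hex : ∀ e ∈ M.filter fun e => Splits R k e ∧ ¬ Splits R (k + 1) e,
      ∃ B ∈ C, crosses B e = 1 := by
    intro e he
    rw [Finset.mem_filter] at he
    obtain ⟨he, hs, hns⟩ := he
    induction e using Sym2.ind with
    | _ a b =>
      rw [hR.splits_mk] at hs
      rw [hR.splits_mk, not_not] at hns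
      have ha := hM.lt_left he
      have hb := hM.lt_right he
      have hca : crosses (cluster R (2 * n) k a) s(a, b) = 1 := by
        rw [crosses_mk, if_neg]
        simp only [Finset.mem_coe, mem_cluster, ha, hb, true_and, (hR.equiv k).refl a, true_iff]
        exact fun h => hs ((hR.equiv k).symm h)
      have hcb : crosses (cluster R (2 * n) k b) s(a, b) = 1 := by
        rw [crosses_mk, if_neg]
        simp only [Finset.mem_coe, mem_cluster, ha, hb, true_and, (hR.equiv k).refl b, iff_true]
        exact hs
      have hle : ∀ B : Set ℕ, crosses B s(a, b) ≤ crossing M B := fun B =>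
        Finset.single_le_sum (f := crosses B) (fun _ _ => Nat.zero_le _) he
      have h1 := hle (cluster R (2 * n) k a)
      have h2 := hle (cluster R (2 * n) k b)
      rcases hB k a b ha hb hns hs with h | ⟨h, -⟩
      · exact ⟨_, Finset.mem_filter.2 ⟨Finset.mem_image_of_mem _ (Finset.mem_range.2 ha),
          by omega⟩, hca⟩
      · exact ⟨_, Finset.mem_filter.2 ⟨Finset.mem_image_of_mem _ (Finset.mem_range.2 hb),
          by omega⟩, hcb⟩
  calc (M.filter fun e => Splits R k e ∧ ¬ Splits R (k + 1) e).card
      ≤ ∑ e ∈ M.filter fun e => Splits R k e ∧ ¬ Splits R (k + 1) e, ∑ B ∈ C, crosses B e := by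
        rw [Finset.card_eq_sum_ones]
        refine Finset.sum_le_sum fun e he => ?_
        obtain ⟨B, hB, hBe⟩ := hex e he
        rw [← hBe]
        exact Finset.single_le_sum (f := fun B : Finset ℕ => crosses B e)
          (fun _ _ => Nat.zero_le _) hB
    _ ≤ ∑ e ∈ M, ∑ B ∈ C, crosses B e := Finset.sum_le_sum_of_subset (Finset.filter_subset _ _)
    _ = ∑ B ∈ C, crossing M B := by rw [Finset.sum_comm]; rfl
    _ ≤ ∑ B ∈ C, crossing M' B := by
        refine Finset.sum_le_sum fun B hB => ?_
        have h1 := (Finset.mem_filter.1 hB).2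
        obtain ⟨u, rfl⟩ := hCcl B hB
        have hlt : ∀ v ∈ cluster R (2 * n) k u, v < 2 * n := fun v hv => (mem_cluster.1 hv).1
        obtain ⟨r, hr⟩ := hM.exists_card_eq _ hlt
        obtain ⟨r', hr'⟩ := hM'.exists_card_eq _ hlt
        omega
    _ = ∑ e ∈ M', ∑ B ∈ C, crosses B e := by rw [Finset.sum_comm]; rfl
    _ ≤ ∑ e ∈ M', if Splits R k e then 2 else 0 := by
        refine Finset.sum_le_sum fun e he => ?_
        induction e using Sym2.ind with
        | _ a b =>
          exact hR.sum_crosses_cluster_le k (hM'.lt_left he) (hM'.lt_right he) C hCcl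
    _ = 2 * (M'.filter (Splits R k)).card := by
        rw [← Finset.sum_filter, Finset.sum_const, smul_eq_mul, mul_comm]

open Classical in
/-- The weight of a balanced matching in terms of the edges of any perfect matching. -/
theorem weight_le {X : Type*} [MetricSpace X] {x : ℕ → X} {n : ℕ} {M M' : Finset (Sym2 ℕ)}
    (hM : IsPerfectMatching n M) (hM' : IsPerfectMatching n M')
    (hB : IsBalancedMatching R (2 * n) M) {k₀ k₁ : ℤ}
    (h₀ : ∀ i j, i < 2 * n → j < 2 * n → i ≠ j → ¬ R k₀ i j)
    (h₁ : ∀ i j, i < 2 * n → j < 2 * n → R k₁ i j)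
    (hd : ∀ k i j, R k i j → dist (x i) (x j) ≤ 4 * 2 ^ k) :
    weight x M ≤ ∑ k ∈ Finset.Ico k₀ k₁, 16 * 2 ^ k * ((M'.filter (Splits R k)).card : ℝ) := by
  have hterm : ∀ e ∈ M, edgeLength x e ≤ ∑ k ∈ Finset.Ico k₀ k₁,
      if Splits R k e ∧ ¬ Splits R (k + 1) e then 8 * (2 : ℝ) ^ k else 0 := by
    intro e he
    induction e using Sym2.ind with
    | _ a b =>
      have ha := hM.lt_left he
      have hb := hM.lt_right he
      -- The edge is charged to the greatest level that splits it; one level higher its ends share a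
      -- cluster of diameter at most 4·2^(k+1).
      obtain ⟨k, hk, hmax⟩ := Int.exists_greatest_of_bdd (P := fun k => ¬ R k a b)
        ⟨k₁, fun k hk => le_of_not_ge fun h => hk (hR.mono h (h₁ a b ha hb))⟩
        ⟨k₀, h₀ a b ha hb (hM.ne he)⟩
      have hk0 : k₀ ≤ k := hmax _ (h₀ a b ha hb (hM.ne he))
      have hk1 : k < k₁ := lt_of_not_ge fun h => hk (hR.mono h (h₁ a b ha hb))
      have hk2 : R (k + 1) a b := by
        by_contra h
        have := hmax _ h
        omega
      refine le_trans ?_ (Finset.single_le_sum (f := fun k => if Splits R k s(a, b) ∧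
        ¬ Splits R (k + 1) s(a, b) then 8 * (2 : ℝ) ^ k else 0) (fun l _ => by
          split_ifs <;> positivity) (Finset.mem_Ico.2 ⟨hk0, hk1⟩))
      rw [if_pos (by rw [hR.splits_mk, hR.splits_mk, not_not]; exact ⟨hk, hk2⟩)]
      refine (hd _ _ _ hk2).trans (le_of_eq ?_)
      rw [zpow_add_one₀ two_ne_zero]
      ring
  calc weight x M ≤ ∑ e ∈ M, ∑ k ∈ Finset.Ico k₀ k₁,
        if Splits R k e ∧ ¬ Splits R (k + 1) e then 8 * (2 : ℝ) ^ k else 0 :=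
        Finset.sum_le_sum hterm
    _ = ∑ k ∈ Finset.Ico k₀ k₁,
        ((M.filter fun e => Splits R k e ∧ ¬ Splits R (k + 1) e).card : ℝ) * (8 * 2 ^ k) := by
        rw [Finset.sum_comm]
        refine Finset.sum_congr rfl fun k _ => ?_
        rw [← Finset.sum_filter, Finset.sum_const, nsmul_eq_mul]
    _ ≤ ∑ k ∈ Finset.Ico k₀ k₁, 16 * 2 ^ k * ((M'.filter (Splits R k)).card : ℝ) := by
        refine Finset.sum_le_sum fun k _ => ?_
        have h := hR.card_filter_le hM hM' hB k
        have h' : ((M.filter fun e => Splits R k e ∧ ¬ Splits R (k + 1) e).card : ℝ) ≤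
            2 * ((M'.filter (Splits R k)).card : ℝ) := by exact_mod_cast h
        have hp : (0 : ℝ) < 2 ^ k := by positivity
        nlinarith

end IsHierarchy

end

/-! ### The online algorithm driven by a level function -/

/-- The relations given by a level function: `i` and `j` are together from level `h i j` on. -/
def levelRel (h : ℕ → ℕ → ℤ) (k : ℤ) (i j : ℕ) : Prop := i = j ∨ h i j ≤ k

open Classical in
/-- A set of edges with property `P` that deletes as few edges of `M` as possible. -/
noncomputable def leastChange (P : Finset (Sym2 ℕ) → Prop) (M fallback : Finset (Sym2 ℕ)) :
    Finset (Sym2 ℕ) :=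
  if H : ∃ M', P M' ∧ ∀ M'', P M'' → (M \ M').card ≤ (M \ M'').card then H.choose else fallback

theorem leastChange_spec {P : Finset (Sym2 ℕ) → Prop} {M N : Finset (Sym2 ℕ)}
    (fallback : Finset (Sym2 ℕ)) (hN : P N) :
    P (leastChange P M fallback) ∧ (M \ leastChange P M fallback).card ≤ (M \ N).card := by
  have H : ∃ M', P M' ∧ ∀ M'', P M'' → (M \ M').card ≤ (M \ M'').card := by
    obtain ⟨M', h1, h2⟩ := exists_minimalFor_of_wellFoundedLT P (fun M' => (M \ M').card) ⟨N, hN⟩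
    exact ⟨M', h1, fun M'' h => (le_total _ _).elim id fun h' => h2 h h'⟩
  rw [leastChange, dif_pos H]
  exact ⟨H.choose_spec.1, H.choose_spec.2 N hN⟩

theorem leastChange_induction {P Q : Finset (Sym2 ℕ) → Prop} {M fallback : Finset (Sym2 ℕ)}
    (h : ∀ N, P N → Q N) (hf : Q fallback) : Q (leastChange P M fallback) := by
  unfold leastChange
  split_ifs with H
  · exact h _ H.choose_spec.1
  · exact hf

/-- The matchings held by the algorithm that keeps the matching balanced with least change. -/
noncomputable def balancedRun (h : ℕ → ℕ → ℤ) : ℕ → Finset (Sym2 ℕ)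
  | 0 => ∅
  -- The fallback keeps the output a perfect matching even for coinciding points, where `levelRel`
  -- may fail to be a hierarchy.
  | n + 1 => leastChange
      (fun M => IsPerfectMatching (n + 1) M ∧ IsBalancedMatching (levelRel h) (2 * (n + 1)) M)
      (balancedRun h n) (insert s(2 * n, 2 * n + 1) (balancedRun h n))

theorem isPerfectMatching_balancedRun (h : ℕ → ℕ → ℤ) (n : ℕ) :
    IsPerfectMatching n (balancedRun h n) := by
  induction n with
  | zero => exact isPerfectMatching_zero
  | succ n ih => exact leastChange_induction (fun N hN => hN.1) ih.insert_pair

/-- The online property of the run; it also reduces measurability to finitely many integers. -/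
theorem balancedRun_congr {h h' : ℕ → ℕ → ℤ} (n : ℕ)
    (H : ∀ i j, i < 2 * n → j < 2 * n → h i j = h' i j) : balancedRun h n = balancedRun h' n := by
  induction n with
  | zero => rfl
  | succ n ih =>
    have hP : (fun M => IsPerfectMatching (n + 1) M ∧
        IsBalancedMatching (levelRel h) (2 * (n + 1)) M) =
        fun M => IsPerfectMatching (n + 1) M ∧
          IsBalancedMatching (levelRel h') (2 * (n + 1)) M := by
      funext M
      rw [isBalancedMatching_congr (R := levelRel h) (R' := levelRel h') fun k u v hu hv => by
        simp only [levelRel, H u v hu hv]]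
    rw [balancedRun, balancedRun, hP, ih fun i j hi hj => H i j (by omega) (by omega)]

/-! ### Balance and recourse of the run. -/

namespace IsHierarchy

variable {R : ℤ → ℕ → ℕ → Prop} (hR : IsHierarchy R)
include hR

theorem hasLargeSibling_mem_Ico {N z : ℕ} (hz : z < N) {k₀ k₁ : ℤ}
    (h₀ : ∀ i j, i < N → j < N → i ≠ j → ¬ R k₀ i j) (h₁ : ∀ i j, i < N → j < N → R k₁ i j)
    {k : ℤ} (hk : HasLargeSibling R N z k) : k ∈ Finset.Ico k₀ k₁ := by
  obtain ⟨v, hv, h1, h2, -⟩ := hk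
  have hvz : v ≠ z := by
    rintro rfl
    exact h2 ((hR.equiv k).refl v)
  rw [Finset.mem_Ico]
  constructor
  · by_contra hlt
    exact h₀ v z hv hz hvz (hR.mono (by omega) h1)
  · by_contra hlt
    exact h2 (hR.mono (by omega) (h₁ v z hv hz))

open Classical in
theorem exists_balanced_succ_le {n : ℕ} {M : Finset (Sym2 ℕ)}
    (hM : IsPerfectMatching n M) (hB : IsBalancedMatching R (2 * n) M) {k₀ k₁ : ℤ}
    (h₀ : ∀ i j, i < 2 * (n + 1) → j < 2 * (n + 1) → i ≠ j → ¬ R k₀ i j)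
    (h₁ : ∀ i j, i < 2 * (n + 1) → j < 2 * (n + 1) → R k₁ i j) {K : ℕ}
    (hK : ∀ z < 2 * (n + 1),
      ((Finset.Ico k₀ k₁).filter (HasLargeSibling R (2 * (n + 1)) z)).card ≤ K) :
    ∃ M', (IsPerfectMatching (n + 1) M' ∧ IsBalancedMatching R (2 * (n + 1)) M') ∧
      (M \ M').card ≤ 12 * K := by
  obtain ⟨M', h1, h2, h3⟩ := hR.exists_balanced_succ hM hB
    (fun z => if z < 2 * (n + 1) then
      (Finset.Ico k₀ k₁).filter (HasLargeSibling R (2 * (n + 1)) z) else ∅) K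
    (fun z _ hz k hk => by
      simp only [hz, if_true, Finset.mem_filter]
      exact ⟨hR.hasLargeSibling_mem_Ico hz h₀ h₁ hk, hk⟩)
    (fun z => by
      split_ifs with hz
      · exact hK z hz
      · simp)
  exact ⟨M', ⟨h1, h2⟩, h3⟩

theorem isBalancedMatching_balancedRun {h : ℕ → ℕ → ℤ} {n : ℕ}
    (hag : ∀ k i j, i < 2 * n → j < 2 * n → (levelRel h k i j ↔ R k i j)) {k₀ k₁ : ℤ}
    (h₀ : ∀ i j, i < 2 * n → j < 2 * n → i ≠ j → ¬ R k₀ i j)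
    (h₁ : ∀ i j, i < 2 * n → j < 2 * n → R k₁ i j) :
    IsBalancedMatching R (2 * n) (balancedRun h n) := by
  classical
  induction n with
  | zero => intro k u v hu; omega
  | succ n ih =>
    have ih' := ih (fun k i j hi hj => hag k i j (by omega) (by omega))
      (fun i j hi hj => h₀ i j (by omega) (by omega))
      (fun i j hi hj => h₁ i j (by omega) (by omega))
    obtain ⟨M', hM', -⟩ := hR.exists_balanced_succ_le (isPerfectMatching_balancedRun h n) ih' h₀ h₁
      (fun z _ => Finset.card_filter_le _ _)
    simp_rw [← isBalancedMatching_congr hag] at hM' ⊢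
    rw [balancedRun]
    exact (leastChange_spec (P := fun M => IsPerfectMatching (n + 1) M ∧
      IsBalancedMatching (levelRel h) (2 * (n + 1)) M) _ hM').1.2

open Classical in
theorem card_balancedRun_sdiff_le {h : ℕ → ℕ → ℤ} {n : ℕ}
    (hag : ∀ k i j, i < 2 * (n + 1) → j < 2 * (n + 1) → (levelRel h k i j ↔ R k i j)) {k₀ k₁ : ℤ}
    (h₀ : ∀ i j, i < 2 * (n + 1) → j < 2 * (n + 1) → i ≠ j → ¬ R k₀ i j)
    (h₁ : ∀ i j, i < 2 * (n + 1) → j < 2 * (n + 1) → R k₁ i j) {K : ℕ}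
    (hK : ∀ z < 2 * (n + 1),
      ((Finset.Ico k₀ k₁).filter (HasLargeSibling R (2 * (n + 1)) z)).card ≤ K) :
    (balancedRun h n \ balancedRun h (n + 1)).card ≤ 12 * K := by
  have hB := hR.isBalancedMatching_balancedRun (n := n)
    (fun k i j hi hj => hag k i j (by omega) (by omega))
    (fun i j hi hj => h₀ i j (by omega) (by omega))
    (fun i j hi hj => h₁ i j (by omega) (by omega))
  obtain ⟨M', hM', hcard⟩ :=
    hR.exists_balanced_succ_le (isPerfectMatching_balancedRun h n) hB h₀ h₁ hK
  simp_rw [← isBalancedMatching_congr hag] at hM'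
  exact (leastChange_spec _ hM').2.trans hcard

theorem card_balancedRun_sdiff_le_depth {h : ℕ → ℕ → ℤ} {n : ℕ}
    (hag : ∀ k i j, i < 2 * (n + 1) → j < 2 * (n + 1) → (levelRel h k i j ↔ R k i j)) {k₀ k₁ : ℤ}
    (h₀ : ∀ i j, i < 2 * (n + 1) → j < 2 * (n + 1) → i ≠ j → ¬ R k₀ i j)
    (h₁ : ∀ i j, i < 2 * (n + 1) → j < 2 * (n + 1) → R k₁ i j) :
    (balancedRun h n \ balancedRun h (n + 1)).card ≤ 12 * (k₁ - k₀).toNat := by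
  classical
  exact hR.card_balancedRun_sdiff_le hag h₀ h₁ fun z _ =>
    (Finset.card_filter_le _ _).trans (Int.card_Ico _ _).le

theorem card_balancedRun_sdiff_le_log {h : ℕ → ℕ → ℤ} {n : ℕ}
    (hag : ∀ k i j, i < 2 * (n + 1) → j < 2 * (n + 1) → (levelRel h k i j ↔ R k i j)) {k₀ k₁ : ℤ}
    (h₀ : ∀ i j, i < 2 * (n + 1) → j < 2 * (n + 1) → i ≠ j → ¬ R k₀ i j)
    (h₁ : ∀ i j, i < 2 * (n + 1) → j < 2 * (n + 1) → R k₁ i j) :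
    ((balancedRun h n \ balancedRun h (n + 1)).card : ℝ) ≤ 48 * Real.log (2 * (n + 1)) := by
  classical
  have hcount : ∀ z < 2 * (n + 1),
      ((Finset.Ico k₀ k₁).filter (HasLargeSibling R (2 * (n + 1)) z)).card ≤
        ⌊4 * Real.log (2 * (n + 1))⌋₊ := by
    intro z hz
    set F := (Finset.Ico k₀ k₁).filter (HasLargeSibling R (2 * (n + 1)) z)
    have h := hR.pow_card_largeSibling_le hz F fun k hk => (Finset.mem_filter.1 hk).2
    have h' : (4 : ℝ) ^ F.card ≤ 3 ^ F.card * (2 * (n + 1)) := by exact_mod_cast h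
    have h3 : (4 / 3 : ℝ) ^ F.card ≤ 2 * (n + 1) := by
      rw [div_pow, div_le_iff₀ (by positivity)]
      linarith
    have h4 := Real.log_le_log (by positivity) h3
    rw [Real.log_pow] at h4
    -- Growth by 4/3 per level thus allows at most 4·log of the number of points such levels; 12·4 =
    -- 48.
    have h5 : (1 / 4 : ℝ) ≤ Real.log (4 / 3) := by
      have := Real.one_sub_inv_le_log_of_pos (show (0 : ℝ) < 4 / 3 by norm_num)
      norm_num at this ⊢
      linarith
    refine Nat.le_floor ?_
    nlinarith [Nat.cast_nonneg (α := ℝ) F.card]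
  have h6 := hR.card_balancedRun_sdiff_le hag h₀ h₁ hcount
  have h7 : ((balancedRun h n \ balancedRun h (n + 1)).card : ℝ) ≤
      12 * (⌊4 * Real.log (2 * (n + 1))⌋₊ : ℝ) := by exact_mod_cast h6
  have h8 : 0 ≤ 4 * Real.log (2 * ((n : ℝ) + 1)) :=
    mul_nonneg (by norm_num) (Real.log_nonneg (by linarith [Nat.cast_nonneg (α := ℝ) n]))
  have h9 := Nat.floor_le h8
  linarith

end IsHierarchy

section

/-! ### Random cells of unit scale -/

/-- The uniform distribution on the unit interval. -/
noncomputable def unitUniform : Measure ℝ := volume.restrict (Set.Ioc 0 1)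

instance : IsProbabilityMeasure unitUniform := ⟨by simp [unitUniform]⟩

/-- The distribution of a uniform point of the unit cube with an independent uniform threshold. -/
noncomputable def seedMeasure (d : ℕ) : Measure ((Fin d → ℝ) × ℝ) :=
  (Measure.pi fun _ => unitUniform).prod unitUniform

instance (d : ℕ) : IsProbabilityMeasure (seedMeasure d) := by
  unfold seedMeasure; infer_instance

variable {d : ℕ}

/-- A periodic bump that vanishes on the boundaries of the cells of the grid with origin `c`. -/
noncomputable def bump (x : EuclideanSpace ℝ (Fin d)) (c : Fin d → ℝ) : ℝ :=
  ∏ i, |Real.sin (Real.pi * (x i - c i))|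

/-- The seed `s` captures the point `x`. -/
def Captures (s : (Fin d → ℝ) × ℝ) (x : EuclideanSpace ℝ (Fin d)) : Prop := s.2 < bump x s.1 ^ 2

/-- The points lie in the same cell of the unit grid with origin `c`. -/
def SameGridCell (c : Fin d → ℝ) (x y : EuclideanSpace ℝ (Fin d)) : Prop :=
  ∀ i, ⌊x i - c i⌋ = ⌊y i - c i⌋

/-- The seed captures one of the two points, but not both in one cell. -/
def Cuts (s : (Fin d → ℝ) × ℝ) (x y : EuclideanSpace ℝ (Fin d)) : Prop :=
  (Captures s x ∨ Captures s y) ∧ ¬ (Captures s x ∧ Captures s y ∧ SameGridCell s.1 x y)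

theorem bump_nonneg (x : EuclideanSpace ℝ (Fin d)) (c : Fin d → ℝ) : 0 ≤ bump x c :=
  Finset.prod_nonneg fun _ _ => abs_nonneg _

theorem bump_le_one (x : EuclideanSpace ℝ (Fin d)) (c : Fin d → ℝ) : bump x c ≤ 1 :=
  Finset.prod_le_one (fun _ _ => abs_nonneg _) fun _ _ => Real.abs_sin_le_one _

theorem continuous_bump (x : EuclideanSpace ℝ (Fin d)) : Continuous (bump x) := by
  unfold bump; fun_prop

theorem measurableSet_captures (x : EuclideanSpace ℝ (Fin d)) :
    MeasurableSet {s | Captures s x} :=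
  measurableSet_lt measurable_snd (((continuous_bump x).measurable.comp measurable_fst).pow_const 2)

theorem measurableSet_sameGridCell (x y : EuclideanSpace ℝ (Fin d)) :
    MeasurableSet {c | SameGridCell c x y} := by
  have : {c | SameGridCell c x y} = ⋂ i, {c : Fin d → ℝ | ⌊x i - c i⌋ = ⌊y i - c i⌋} := by
    ext c; simp [SameGridCell]
  rw [this]
  exact MeasurableSet.iInter fun i => measurableSet_eq_fun
    (Int.measurable_floor.comp (by fun_prop)) (Int.measurable_floor.comp (by fun_prop))

theorem measurableSet_cuts (x y : EuclideanSpace ℝ (Fin d)) : MeasurableSet {s | Cuts s x y} :=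
  ((measurableSet_captures x).union (measurableSet_captures y)).inter
    ((measurableSet_captures x).inter ((measurableSet_captures y).inter
      (measurable_fst (measurableSet_sameGridCell x y)))).compl

theorem integral_sin_sq_unitUniform (x : ℝ) :
    ∫ c, |Real.sin (Real.pi * (x - c))| ^ 2 ∂unitUniform = 1 / 2 := by
  simp_rw [sq_abs]
  rw [unitUniform, ← intervalIntegral.integral_of_le zero_le_one]
  have h := intervalIntegral.integral_comp_sub_mul (fun u => Real.sin u ^ 2)
    (a := 0) (b := 1) Real.pi_ne_zero (Real.pi * x)
  simp_rw [← mul_sub] at h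
  rw [h, integral_sin_sq, smul_eq_mul]
  have h1 : Real.sin (Real.pi * (x - 1)) = -Real.sin (Real.pi * x) := by
    rw [mul_sub, mul_one, Real.sin_sub_pi]
  have h2 : Real.cos (Real.pi * (x - 1)) = -Real.cos (Real.pi * x) := by
    rw [mul_sub, mul_one, Real.cos_sub_pi]
  rw [h1, h2, sub_zero]
  field_simp
  ring

theorem abs_sin_pi_mul_le (u : ℝ) (m : ℤ) :
    |Real.sin (Real.pi * u)| ≤ Real.pi * |u - m| := by
  have h : |Real.sin (Real.pi * u)| = |Real.sin (Real.pi * (u - m))| := by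
    rw [mul_sub, mul_comm Real.pi (m : ℝ), Real.sin_sub_int_mul_pi, abs_mul, abs_zpow, abs_neg,
      abs_one, one_zpow, one_mul]
  rw [h]
  refine (Real.abs_sin_le_abs).trans ?_
  rw [abs_mul, abs_of_pos Real.pi_pos]

theorem exists_int_between {u v : ℝ} (h : ⌊u⌋ ≠ ⌊v⌋) :
    ∃ m : ℤ, |u - m| + |v - m| = |u - v| := by
  rcases lt_or_gt_of_ne h with h | h
  · refine ⟨⌊v⌋, ?_⟩
    have h1 : u < ⌊v⌋ := Int.floor_lt.1 h
    have h2 := Int.floor_le v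
    rw [abs_of_nonpos (by linarith), abs_of_nonneg (by linarith), abs_of_nonpos (by linarith)]
    ring
  · refine ⟨⌊u⌋, ?_⟩
    have h1 : v < ⌊u⌋ := Int.floor_lt.1 h
    have h2 := Int.floor_le u
    rw [abs_of_nonneg (by linarith), abs_of_nonpos (by linarith), abs_of_nonneg (by linarith)]
    ring

/-- In a common cell the claim is that t ↦ |sin πt| is π-Lipschitz. In different cells an integer
lies between `u` and `v`; the sine vanishes there, so the two values add up to at most π|u−v|. -/
theorem abs_sin_correlation (u v : ℝ) :
    |Real.sin (Real.pi * u)| ^ 2 + |Real.sin (Real.pi * v)| ^ 2 - Real.pi ^ 2 * (u - v) ^ 2 ≤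
      2 * if ⌊u⌋ = ⌊v⌋ then |Real.sin (Real.pi * u)| * |Real.sin (Real.pi * v)| else 0 := by
  have hp := Real.pi_pos
  split_ifs with h
  · have h1 : |(|Real.sin (Real.pi * u)| - |Real.sin (Real.pi * v)|)| ≤ Real.pi * |u - v| := by
      refine (abs_abs_sub_abs_le _ _).trans ?_
      have := Real.abs_sin_sub_sin_le (Real.pi * u) (Real.pi * v)
      rwa [← mul_sub, abs_mul, abs_of_pos hp] at this
    have h2 := pow_le_pow_left₀ (abs_nonneg _) h1 2
    rw [sq_abs, mul_pow, sq_abs] at h2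
    nlinarith
  · obtain ⟨m, hm⟩ := exists_int_between h
    have h1 := abs_sin_pi_mul_le u m
    have h2 := abs_sin_pi_mul_le v m
    have h3 : |Real.sin (Real.pi * u)| + |Real.sin (Real.pi * v)| ≤ Real.pi * |u - v| := by
      rw [← hm]; linarith
    have h4 := pow_le_pow_left₀ (by positivity) h3 2
    rw [mul_pow, sq_abs] at h4
    nlinarith [abs_nonneg (Real.sin (Real.pi * u)), abs_nonneg (Real.sin (Real.pi * v))]

end

/-! ### The probability that a single seed cuts a pair of points. -/

section

variable {d : ℕ}

open Classical in
/-- The product of the two bumps where the points lie in the same grid cell. -/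
noncomputable def jointBump (x y : EuclideanSpace ℝ (Fin d)) (c : Fin d → ℝ) : ℝ :=
  if SameGridCell c x y then bump x c * bump y c else 0

/-- The cube law of the grid origin. -/
noncomputable def originMeasure (d : ℕ) : Measure (Fin d → ℝ) := Measure.pi fun _ => unitUniform

instance (d : ℕ) : IsProbabilityMeasure (originMeasure d) := by
  unfold originMeasure; infer_instance

theorem sameGridCell_comm {c : Fin d → ℝ} {x y : EuclideanSpace ℝ (Fin d)} :
    SameGridCell c x y ↔ SameGridCell c y x := forall_congr' fun _ => eq_comm

theorem one_sub_sum_le_prod {ι : Type*} (s : Finset ι) (t : ι → ℝ) (h0 : ∀ i ∈ s, 0 ≤ t i)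
    (h1 : ∀ i ∈ s, t i ≤ 1) : 1 - ∑ i ∈ s, (1 - t i) ≤ ∏ i ∈ s, t i := by
  classical
  induction s using Finset.induction_on with
  | empty => simp
  | insert a s ha ih =>
    have ih' := ih (fun i hi => h0 i (Finset.mem_insert_of_mem hi))
      fun i hi => h1 i (Finset.mem_insert_of_mem hi)
    rw [Finset.sum_insert ha, Finset.prod_insert ha]
    have hp1 : ∏ i ∈ s, t i ≤ 1 := Finset.prod_le_one
      (fun i hi => h0 i (Finset.mem_insert_of_mem hi))
      fun i hi => h1 i (Finset.mem_insert_of_mem hi)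
    have ha0 := h0 a (Finset.mem_insert_self _ _)
    have ha1 := h1 a (Finset.mem_insert_self _ _)
    nlinarith

theorem integral_bump_sq (x : EuclideanSpace ℝ (Fin d)) :
    ∫ c, bump x c ^ 2 ∂originMeasure d = (1 / 2) ^ d := by
  simp_rw [bump, ← Finset.prod_pow]
  rw [originMeasure, integral_fintype_prod_eq_prod
    (f := fun i c => |Real.sin (Real.pi * (x i - c))| ^ 2)]
  simp_rw [integral_sin_sq_unitUniform]
  simp

theorem integrable_bump_sq (x : EuclideanSpace ℝ (Fin d)) :
    Integrable (fun c => bump x c ^ 2) (originMeasure d) := by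
  refine Integrable.of_bound ((continuous_bump x).pow 2).aestronglyMeasurable 1 ?_
  refine Filter.Eventually.of_forall fun c => ?_
  rw [Real.norm_eq_abs, abs_of_nonneg (sq_nonneg _)]
  exact pow_le_one₀ (bump_nonneg x c) (bump_le_one x c)

theorem jointBump_nonneg (x y : EuclideanSpace ℝ (Fin d)) (c : Fin d → ℝ) : 0 ≤ jointBump x y c := by
  unfold jointBump
  split_ifs
  · exact mul_nonneg (bump_nonneg _ _) (bump_nonneg _ _)
  · exact le_rfl

theorem integrable_jointBump (x y : EuclideanSpace ℝ (Fin d)) :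
    Integrable (jointBump x y) (originMeasure d) := by
  classical
  refine Integrable.of_bound (Measurable.ite (measurableSet_sameGridCell x y)
    ((continuous_bump x).mul (continuous_bump y)).measurable
    measurable_const).aestronglyMeasurable 1 ?_
  refine Filter.Eventually.of_forall fun c => ?_
  rw [Real.norm_eq_abs, abs_of_nonneg (jointBump_nonneg x y c)]
  unfold jointBump
  split_ifs
  · exact mul_le_one₀ (bump_le_one _ _) (bump_nonneg _ _) (bump_le_one _ _)
  · exact zero_le_one

open Classical in
-- `abs_sin_correlation` and the inequality of the means, averaged over the shift. The factor 2
-- divides by the mean 1/2 of sin², which puts the quantity in [0, 1] as `one_sub_sum_le_prod`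
-- requires.
theorem integral_abs_sin_mul_bounds (u v : ℝ) :
    1 - Real.pi ^ 2 * (u - v) ^ 2 ≤ 2 * ∫ c, (if ⌊u - c⌋ = ⌊v - c⌋ then
        |Real.sin (Real.pi * (u - c))| * |Real.sin (Real.pi * (v - c))| else 0) ∂unitUniform ∧
      2 * ∫ c, (if ⌊u - c⌋ = ⌊v - c⌋ then
        |Real.sin (Real.pi * (u - c))| * |Real.sin (Real.pi * (v - c))| else 0) ∂unitUniform ≤ 1 := by
  have hsq : ∀ w : ℝ, Integrable (fun c => |Real.sin (Real.pi * (w - c))| ^ 2) unitUniform := by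
    intro w
    refine Integrable.of_bound (by fun_prop) 1 (Filter.Eventually.of_forall fun c => ?_)
    rw [Real.norm_eq_abs, abs_of_nonneg (by positivity)]
    exact pow_le_one₀ (abs_nonneg _) (Real.abs_sin_le_one _)
  have hJ : Integrable (fun c => if ⌊u - c⌋ = ⌊v - c⌋ then
        |Real.sin (Real.pi * (u - c))| * |Real.sin (Real.pi * (v - c))| else 0) unitUniform := by
    refine Integrable.of_bound (Measurable.ite (measurableSet_eq_fun
      (Int.measurable_floor.comp (by fun_prop)) (Int.measurable_floor.comp (by fun_prop)))
      (by fun_prop) measurable_const).aestronglyMeasurable 1 (Filter.Eventually.of_forall fun c => ?_)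
    rw [Real.norm_eq_abs]
    split_ifs
    · rw [abs_of_nonneg (by positivity)]
      exact mul_le_one₀ (Real.abs_sin_le_one _) (abs_nonneg _) (Real.abs_sin_le_one _)
    · simp
  have hsum : ∫ c, (|Real.sin (Real.pi * (u - c))| ^ 2 + |Real.sin (Real.pi * (v - c))| ^ 2)
      ∂unitUniform = 1 := by
    rw [integral_add (hsq u) (hsq v), integral_sin_sq_unitUniform, integral_sin_sq_unitUniform]
    norm_num
  rw [← integral_const_mul]
  constructor
  · have h1 : ∫ c, (|Real.sin (Real.pi * (u - c))| ^ 2 + |Real.sin (Real.pi * (v - c))| ^ 2 -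
        Real.pi ^ 2 * (u - v) ^ 2) ∂unitUniform = 1 - Real.pi ^ 2 * (u - v) ^ 2 := by
      have h2 : Integrable (fun c => |Real.sin (Real.pi * (u - c))| ^ 2 +
          |Real.sin (Real.pi * (v - c))| ^ 2) unitUniform := (hsq u).add (hsq v)
      rw [integral_sub h2 (integrable_const _), hsum]
      simp
    rw [← h1]
    refine integral_mono (((hsq u).add (hsq v)).sub (integrable_const _)) (hJ.const_mul 2) ?_
    intro c
    have := abs_sin_correlation (u - c) (v - c)
    rwa [sub_sub_sub_cancel_right] at this
  · rw [← hsum]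
    refine integral_mono (hJ.const_mul 2) ((hsq u).add (hsq v)) fun c => ?_
    split_ifs
    · nlinarith [sq_nonneg (|Real.sin (Real.pi * (u - c))| - |Real.sin (Real.pi * (v - c))|)]
    · rw [mul_zero]
      positivity

/-- The coordinates of the origin are independent, so the integral is a product. The coordinatewise
losses are quadratic and add up to the squared Euclidean distance; this is why no dimension factor
appears. -/
theorem integral_jointBump_ge (x y : EuclideanSpace ℝ (Fin d)) :
    (1 / 2) ^ d * (1 - Real.pi ^ 2 * dist x y ^ 2) ≤ ∫ c, jointBump x y c ∂originMeasure d := by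
  classical
  set J : Fin d → ℝ := fun i => ∫ c, (if ⌊x i - c⌋ = ⌊y i - c⌋ then
        |Real.sin (Real.pi * (x i - c))| * |Real.sin (Real.pi * (y i - c))| else 0) ∂unitUniform
    with hJ
  have hprod : ∫ c, jointBump x y c ∂originMeasure d = ∏ i, J i := by
    rw [hJ, originMeasure, ← integral_fintype_prod_eq_prod
      (f := fun i c => if ⌊x i - c⌋ = ⌊y i - c⌋ then
        |Real.sin (Real.pi * (x i - c))| * |Real.sin (Real.pi * (y i - c))| else 0)]
    refine integral_congr_ae (Filter.Eventually.of_forall fun c => ?_)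
    simp only [jointBump, SameGridCell, bump]
    rw [Finset.prod_ite_zero, Finset.prod_mul_distrib]
    simp
  have hJ0 : ∀ i, 0 ≤ J i := fun i => integral_nonneg fun c => by
    dsimp only; split_ifs <;> positivity
  have h2 : ∏ i, J i = (1 / 2) ^ d * ∏ i, (2 * J i) := by
    rw [Finset.prod_mul_distrib, Finset.prod_const, Finset.card_univ, Fintype.card_fin, ← mul_assoc,
      ← mul_pow]
    norm_num
  rw [hprod, h2]
  refine mul_le_mul_of_nonneg_left ?_ (by positivity)
  refine le_trans ?_ (one_sub_sum_le_prod Finset.univ (fun i => 2 * J i)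
    (fun i _ => mul_nonneg zero_le_two (hJ0 i)) fun i _ => (integral_abs_sin_mul_bounds _ _).2)
  rw [EuclideanSpace.dist_eq, Real.sq_sqrt (Finset.sum_nonneg fun _ _ => sq_nonneg _),
    Finset.mul_sum]
  refine sub_le_sub_left (Finset.sum_le_sum fun i _ => ?_) 1
  have := (integral_abs_sin_mul_bounds (x i) (y i)).1
  rw [Real.dist_eq, sq_abs]
  linarith

theorem unitUniform_Iio_le (a : ℝ) : unitUniform (Set.Iio a) ≤ ENNReal.ofReal a := by
  rw [unitUniform, Measure.restrict_apply measurableSet_Iio]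
  calc volume (Set.Iio a ∩ Set.Ioc 0 1) ≤ volume (Set.Ioo 0 a) :=
        measure_mono fun t ht => ⟨ht.2.1, ht.1⟩
    _ = ENNReal.ofReal a := by simp

theorem unitUniform_Iio {a : ℝ} (h1 : a ≤ 1) : unitUniform (Set.Iio a) = ENNReal.ofReal a := by
  rw [unitUniform, Measure.restrict_apply measurableSet_Iio]
  have : Set.Iio a ∩ Set.Ioc 0 1 = Set.Ioo 0 a := by
    ext t
    simp only [Set.mem_inter_iff, Set.mem_Iio, Set.mem_Ioc, Set.mem_Ioo]
    constructor
    · exact fun h => ⟨h.2.1, h.1⟩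
    · exact fun h => ⟨h.2, h.1, by linarith [h.2]⟩
  rw [this]
  simp

theorem unitUniform_Ico_le (a b : ℝ) : unitUniform (Set.Ico a b) ≤ ENNReal.ofReal (b - a) :=
  (Measure.restrict_apply_le _ _).trans (by simp)

theorem seedMeasure_captures (x : EuclideanSpace ℝ (Fin d)) :
    seedMeasure d {s | Captures s x} = ENNReal.ofReal ((1 / 2) ^ d) := by
  rw [seedMeasure, Measure.prod_apply (measurableSet_captures x), ← integral_bump_sq x,
    ofReal_integral_eq_lintegral_ofReal (integrable_bump_sq x)
      (Filter.Eventually.of_forall fun c => sq_nonneg _)]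
  refine lintegral_congr fun c => ?_
  exact unitUniform_Iio (pow_le_one₀ (bump_nonneg x c) (bump_le_one x c))

/-- With a ≤ b the two bumps, the cut has probability at most b²−a² in a common cell and at most b²
otherwise. Splitting (b−a)(b+a) with weight ε yields the square (b−a)², whose mean is controlled by
`integral_jointBump_ge`. -/
theorem unitUniform_cuts_le (x y : EuclideanSpace ℝ (Fin d)) (c : Fin d → ℝ) {ε : ℝ} (hε : 0 < ε) :
    unitUniform {t | Cuts (c, t) x y} ≤ ENNReal.ofReal
      ((bump x c ^ 2 + bump y c ^ 2 - 2 * jointBump x y c) / (2 * ε) +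
        ε * (bump x c ^ 2 + bump y c ^ 2)) := by
  wlog h : bump x c ≤ bump y c generalizing x y with H
  · classical
    have := H y x (le_of_not_ge h)
    have e1 : {t | Cuts (c, t) x y} = {t | Cuts (c, t) y x} := by
      ext t
      simp only [Cuts, Set.mem_ofPred_eq]
      rw [sameGridCell_comm]
      tauto
    have e2 : jointBump x y c = jointBump y x c := by
      exact if_congr sameGridCell_comm (mul_comm _ _) rfl
    rwa [e1, e2, add_comm (bump x c ^ 2)]
  have hx := bump_nonneg x c
  have hy := bump_nonneg y c
  set a := bump x c
  set b := bump y c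
  by_cases hs : SameGridCell c x y
  · have h1 : {t | Cuts (c, t) x y} ⊆ Set.Ico (a ^ 2) (b ^ 2) := by
      intro t ht
      simp only [Cuts, Captures, Set.mem_ofPred_eq, hs, and_true] at ht
      have hab : a ^ 2 ≤ b ^ 2 := pow_le_pow_left₀ hx h 2
      rw [Set.mem_Ico]
      change (t < a ^ 2 ∨ t < b ^ 2) ∧ ¬ (t < a ^ 2 ∧ t < b ^ 2) at ht
      grind
    refine (measure_mono h1).trans ((unitUniform_Ico_le _ _).trans (ENNReal.ofReal_le_ofReal ?_))
    rw [jointBump, if_pos hs]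
    change b ^ 2 - a ^ 2 ≤ (a ^ 2 + b ^ 2 - 2 * (a * b)) / (2 * ε) + ε * (a ^ 2 + b ^ 2)
    have h2 : b ^ 2 - a ^ 2 ≤ (b - a) ^ 2 / (2 * ε) + ε / 2 * (b + a) ^ 2 := by
      rw [div_add' _ _ _ (by positivity), le_div_iff₀ (by positivity)]
      nlinarith [sq_nonneg ((b - a) - ε * (b + a))]
    have h3 : ε / 2 * (b + a) ^ 2 ≤ ε * (a ^ 2 + b ^ 2) := by
      nlinarith [mul_nonneg hε.le (sq_nonneg (b - a))]
    have h4 : (b - a) ^ 2 = a ^ 2 + b ^ 2 - 2 * (a * b) := by ring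
    rw [← h4]
    linarith
  · have h1 : {t | Cuts (c, t) x y} ⊆ Set.Iio (b ^ 2) := by
      intro t ht
      have hab : a ^ 2 ≤ b ^ 2 := pow_le_pow_left₀ hx h 2
      rcases ht.1 with h | h
      · exact lt_of_lt_of_le h hab
      · exact h
    refine (measure_mono h1).trans ((unitUniform_Iio_le _).trans (ENNReal.ofReal_le_ofReal ?_))
    rw [jointBump, if_neg hs, mul_zero, sub_zero]
    have h2 : a ^ 2 + b ^ 2 ≤ (a ^ 2 + b ^ 2) / (2 * ε) + ε * (a ^ 2 + b ^ 2) := by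
      rw [div_add' _ _ _ (by positivity), le_div_iff₀ (by positivity)]
      nlinarith [mul_nonneg (by positivity : 0 ≤ a ^ 2 + b ^ 2)
        (by nlinarith [sq_nonneg (1 - ε), sq_nonneg ε] : 0 ≤ 1 - 2 * ε + 2 * ε ^ 2)]
    nlinarith

theorem seedMeasure_cuts_le {x y : EuclideanSpace ℝ (Fin d)} (hxy : x ≠ y) :
    seedMeasure d {s | Cuts s x y} ≤
      ENNReal.ofReal ((1 / 2) ^ d) * ENNReal.ofReal (3 * Real.pi * dist x y) := by
  have hD : 0 < dist x y := dist_pos.2 hxy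
  -- With Q = 2^(−d), the first term integrates to at most Qε and the second to 2Qε, hence the
  -- constant 3π.
  set ε := Real.pi * dist x y with hε
  have hε0 : 0 < ε := mul_pos Real.pi_pos hD
  have hi : Integrable (fun c => (bump x c ^ 2 + bump y c ^ 2 - 2 * jointBump x y c) / (2 * ε) +
        ε * (bump x c ^ 2 + bump y c ^ 2)) (originMeasure d) :=
    ((((integrable_bump_sq x).add (integrable_bump_sq y)).sub
      ((integrable_jointBump x y).const_mul 2)).div_const _).add
      (((integrable_bump_sq x).add (integrable_bump_sq y)).const_mul ε)
  have hnn : ∀ c, 0 ≤ (bump x c ^ 2 + bump y c ^ 2 - 2 * jointBump x y c) / (2 * ε) +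
        ε * (bump x c ^ 2 + bump y c ^ 2) := by
    intro c
    have : 0 ≤ bump x c ^ 2 + bump y c ^ 2 - 2 * jointBump x y c := by
      unfold jointBump
      split_ifs
      · nlinarith [sq_nonneg (bump x c - bump y c)]
      · nlinarith [sq_nonneg (bump x c), sq_nonneg (bump y c)]
    positivity
  calc seedMeasure d {s | Cuts s x y}
      = ∫⁻ c, unitUniform {t | Cuts (c, t) x y} ∂originMeasure d := by
        rw [seedMeasure, Measure.prod_apply (measurableSet_cuts x y)]; rfl
    _ ≤ ∫⁻ c, ENNReal.ofReal ((bump x c ^ 2 + bump y c ^ 2 - 2 * jointBump x y c) / (2 * ε) +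
        ε * (bump x c ^ 2 + bump y c ^ 2)) ∂originMeasure d :=
        lintegral_mono fun c => unitUniform_cuts_le x y c hε0
    _ = ENNReal.ofReal (∫ c, ((bump x c ^ 2 + bump y c ^ 2 - 2 * jointBump x y c) / (2 * ε) +
        ε * (bump x c ^ 2 + bump y c ^ 2)) ∂originMeasure d) :=
        (ofReal_integral_eq_lintegral_ofReal hi (Filter.Eventually.of_forall hnn)).symm
    _ ≤ ENNReal.ofReal ((1 / 2) ^ d * (3 * Real.pi * dist x y)) := by
        refine ENNReal.ofReal_le_ofReal ?_
        rw [integral_add, integral_div, integral_sub, integral_const_mul, integral_const_mul,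
          integral_add (integrable_bump_sq x) (integrable_bump_sq y), integral_bump_sq,
          integral_bump_sq]
        rotate_left
        · exact (integrable_bump_sq x).add (integrable_bump_sq y)
        · exact (integrable_jointBump x y).const_mul 2
        · exact (((integrable_bump_sq x).add (integrable_bump_sq y)).sub
            ((integrable_jointBump x y).const_mul 2)).div_const _
        · exact ((integrable_bump_sq x).add (integrable_bump_sq y)).const_mul ε
        have h := integral_jointBump_ge x y
        rw [← mul_pow, ← hε] at h
        set Q : ℝ := (1 / 2) ^ d
        have h1 : (Q + Q - 2 * ∫ c, jointBump x y c ∂originMeasure d) / (2 * ε) ≤ Q * ε := by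
          rw [div_le_iff₀ (by positivity)]
          nlinarith
        have h2 : Q * (3 * Real.pi * dist x y) = 3 * (Q * ε) := by rw [hε]; ring
        rw [h2]
        linarith
    _ = _ := ENNReal.ofReal_mul (by positivity)

/-! ### Random cells from a sequence of seeds -/

/-- The law of a sequence of independent seeds. -/
noncomputable def seedsMeasure (d : ℕ) : Measure (ℕ → (Fin d → ℝ) × ℝ) :=
  Measure.infinitePi fun _ => seedMeasure d

instance (d : ℕ) : IsProbabilityMeasure (seedsMeasure d) := by
  unfold seedsMeasure; infer_instance

/-- The two points are captured by the same seed first, and in the same cell of its grid. -/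
def SameCell (w : ℕ → (Fin d → ℝ) × ℝ) (x y : EuclideanSpace ℝ (Fin d)) : Prop :=
  -- The first alternative makes a point that is never captured a cell of its own, so that this is
  -- an equivalence relation for every outcome.
  x = y ∨ ∃ m, (∀ i < m, ¬ Captures (w i) x ∧ ¬ Captures (w i) y) ∧
    Captures (w m) x ∧ Captures (w m) y ∧ SameGridCell (w m).1 x y

theorem sameCell_equivalence (w : ℕ → (Fin d → ℝ) × ℝ) : Equivalence (SameCell w) where
  refl x := Or.inl rfl
  symm {x y} h := by
    rcases h with h | ⟨m, h1, h2, h3, h4⟩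
    · exact Or.inl h.symm
    · exact Or.inr ⟨m, fun i hi => (h1 i hi).symm, h3, h2, fun i => (h4 i).symm⟩
  trans {x y z} h h' := by
    rcases h with rfl | ⟨m, h1, h2, h3, h4⟩
    · exact h'
    rcases h' with rfl | ⟨m', h1', h2', h3', h4'⟩
    · exact Or.inr ⟨m, h1, h2, h3, h4⟩
    have hm : m = m' := by
      rcases lt_trichotomy m m' with hlt | heq | hgt
      · exact absurd h3 (h1' m hlt).1
      · exact heq
      · exact absurd h2' (h1 m' hgt).2
    subst hm
    exact Or.inr ⟨m, fun i hi => ⟨(h1 i hi).1, (h1' i hi).2⟩, h2, h3',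
      fun i => (h4 i).trans (h4' i)⟩

theorem SameCell.dist_le {w : ℕ → (Fin d → ℝ) × ℝ} {x y : EuclideanSpace ℝ (Fin d)}
    (h : SameCell w x y) : dist x y ≤ √(d : ℝ) := by
  rcases h with rfl | ⟨m, -, -, -, h⟩
  · rw [dist_self]; positivity
  rw [EuclideanSpace.dist_eq]
  refine Real.sqrt_le_sqrt ?_
  calc ∑ i, dist (x i) (y i) ^ 2 ≤ ∑ _i : Fin d, (1 : ℝ) := by
        refine Finset.sum_le_sum fun i _ => pow_le_one₀ dist_nonneg ?_
        have := Int.abs_sub_lt_one_of_floor_eq_floor (h i)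
        rw [sub_sub_sub_cancel_right] at this
        rw [Real.dist_eq]
        exact this.le
    _ = d := by simp

theorem measurableSet_sameCell (x y : EuclideanSpace ℝ (Fin d)) :
    MeasurableSet {w | SameCell w x y} := by
  by_cases hxy : x = y
  · have : {w | SameCell w x y} = Set.univ := Set.eq_univ_of_forall fun w => Or.inl hxy
    rw [this]; exact MeasurableSet.univ
  have hc : ∀ (z : EuclideanSpace ℝ (Fin d)) (i : ℕ),
      MeasurableSet {w : ℕ → (Fin d → ℝ) × ℝ | Captures (w i) z} := fun z i =>
    (measurable_pi_apply (X := fun _ : ℕ => (Fin d → ℝ) × ℝ) i) (measurableSet_captures z)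
  have : {w | SameCell w x y} = ⋃ m : ℕ, (⋂ i ∈ Finset.range m,
      ({w | Captures (w i) x}ᶜ ∩ {w | Captures (w i) y}ᶜ)) ∩ ({w | Captures (w m) x} ∩
        ({w | Captures (w m) y} ∩ {w | SameGridCell (w m).1 x y})) := by
    ext w
    simp [SameCell, hxy]
  rw [this]
  refine MeasurableSet.iUnion fun m => (Finset.measurableSet_biInter _ fun i _ =>
    (hc x i).compl.inter (hc y i).compl).inter ((hc x m).inter ((hc y m).inter ?_))
  exact (measurable_fst.comp (measurable_pi_apply m)) (measurableSet_sameGridCell x y)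

/-- Each seed captures `x` with probability q = 2^(−d) and cuts the pair with probability at most
3πq·dist. Summing over the time of the first capture, the geometric series cancels the exponentially
small q. -/
theorem seedsMeasure_not_sameCell_le (x y : EuclideanSpace ℝ (Fin d)) :
    seedsMeasure d {w | ¬ SameCell w x y} ≤ ENNReal.ofReal (3 * Real.pi * dist x y) := by
  by_cases hxy : x = y
  · have : {w | ¬ SameCell w x y} = ∅ := Set.eq_empty_of_forall_notMem fun w h => h (Or.inl hxy)
    rw [this]; simp
  set q := ENNReal.ofReal ((1 / 2) ^ d) with hq
  have hq0 : q ≠ 0 := by rw [hq]; simp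
  have hq1 : q ≤ 1 := by
    rw [hq, ← ENNReal.ofReal_one]
    exact ENNReal.ofReal_le_ofReal (pow_le_one₀ (by norm_num) (by norm_num))
  have hqt : q ≠ ⊤ := ENNReal.ofReal_ne_top
  set miss : Set ((Fin d → ℝ) × ℝ) := {s | Captures s x}ᶜ with hmiss
  have hmissm : MeasurableSet miss := (measurableSet_captures x).compl
  have hmissq : seedMeasure d miss = 1 - q := by
    rw [hmiss, prob_compl_eq_one_sub (measurableSet_captures x), seedMeasure_captures]
  -- Recording only the misses of `x` before time `m` gives the factor (1−q)^m exactly; the misses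
  -- of `y` are not needed for an upper bound.
  set A : ℕ → Set (ℕ → (Fin d → ℝ) × ℝ) := fun m => Set.pi (Finset.range (m + 1))
    fun i => if i < m then miss else {s | Cuts s x y} with hA
  set Z : Set (ℕ → (Fin d → ℝ) × ℝ) := {w | ∀ i, w i ∈ miss} with hZ
  have hsub : {w | ¬ SameCell w x y} ⊆ (⋃ m, A m) ∪ Z := by
    intro w hw
    by_cases hcap : ∃ m, Captures (w m) x ∨ Captures (w m) y
    · left
      classical
      have h1 := Nat.find_spec hcap
      have h2 : ∀ i < Nat.find hcap, ¬ Captures (w i) x ∧ ¬ Captures (w i) y := fun i hi =>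
        not_or.1 (Nat.find_min hcap hi)
      refine Set.mem_iUnion.2 ⟨Nat.find hcap, ?_⟩
      intro i hi
      rw [Finset.mem_coe, Finset.mem_range] at hi
      dsimp only
      split_ifs with him
      · exact (h2 i him).1
      · have hi' : i = Nat.find hcap := by omega
        subst hi'
        exact ⟨h1, fun h => hw (Or.inr ⟨_, h2, h⟩)⟩
    · right
      push Not at hcap
      exact fun i => (hcap i).1
  have hAm : ∀ m, seedsMeasure d (A m) =
      (1 - q) ^ m * seedMeasure d {s | Cuts s x y} := by
    intro m
    rw [hA, seedsMeasure, Measure.infinitePi_pi]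
    · rw [Finset.prod_range_succ, if_neg (lt_irrefl m)]
      congr 1
      rw [Finset.prod_congr rfl (g := fun _ => 1 - q), Finset.prod_const, Finset.card_range]
      intro i hi
      rw [if_pos (Finset.mem_range.1 hi), hmissq]
    · intro i _
      split_ifs
      · exact hmissm
      · exact measurableSet_cuts x y
  have hZ0 : seedsMeasure d Z = 0 := by
    have hlt : 1 - q < 1 := ENNReal.sub_lt_self ENNReal.one_ne_top one_ne_zero hq0
    refine le_antisymm (ge_of_tendsto' (ENNReal.tendsto_pow_atTop_nhds_zero_of_lt_one hlt)
      fun m => ?_) zero_le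
    calc seedsMeasure d Z ≤ seedsMeasure d (Set.pi (Finset.range m) fun _ => miss) :=
          measure_mono fun w hw i _ => hw i
      _ = (1 - q) ^ m := by
          have h := Measure.infinitePi_pi (μ := fun _ : ℕ => seedMeasure d) (s := Finset.range m)
            (t := fun _ => miss) fun _ _ => hmissm
          refine h.trans ?_
          rw [Finset.prod_congr rfl fun _ _ => hmissq, Finset.prod_const, Finset.card_range]
  calc seedsMeasure d {w | ¬ SameCell w x y}
      ≤ seedsMeasure d (⋃ m, A m) + seedsMeasure d Z :=
        (measure_mono hsub).trans (measure_union_le _ _)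
    _ ≤ ∑' m, seedsMeasure d (A m) := by rw [hZ0, add_zero]; exact measure_iUnion_le _
    _ = (1 - (1 - q))⁻¹ * seedMeasure d {s | Cuts s x y} := by
        simp_rw [hAm]
        rw [ENNReal.tsum_mul_right, ENNReal.tsum_geometric]
    _ ≤ q⁻¹ * (q * ENNReal.ofReal (3 * Real.pi * dist x y)) := by
        rw [ENNReal.sub_sub_cancel ENNReal.one_ne_top hq1]
        gcongr
        exact seedMeasure_cuts_le hxy
    _ = ENNReal.ofReal (3 * Real.pi * dist x y) := by
        rw [← mul_assoc, ENNReal.inv_mul_cancel hq0 hqt, one_mul]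

end

section

variable {d : ℕ}

/-! ### The random hierarchy of cells -/

/-- The random bits: a sequence of seeds for the cells and one number for the radii. -/
abbrev RandomBits (d : ℕ) : Type := (ℕ → (Fin d → ℝ) × ℝ) × ℝ

/-- The law of the random bits. -/
noncomputable def bitsMeasure (d : ℕ) : Measure (RandomBits d) := (seedsMeasure d).prod unitUniform

instance (d : ℕ) : IsProbabilityMeasure (bitsMeasure d) := by
  unfold bitsMeasure; infer_instance

/-- The radius at level `j` of the ball that is contracted to one cell. -/
noncomputable def ballRadius (u : ℝ) (j : ℤ) : ℝ := 2 ^ j * (1 + max 0 (min u 1))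

/-- The clamp in the radius makes the bounds hold for every `u` and not only almost surely, as a
recourse bound for every outcome requires. -/
theorem le_ballRadius (u : ℝ) (j : ℤ) : (2 : ℝ) ^ j ≤ ballRadius u j :=
  le_mul_of_one_le_right (by positivity) (by linarith [le_max_left 0 (min u 1)])

theorem ballRadius_le (u : ℝ) (j : ℤ) : ballRadius u j ≤ 2 * 2 ^ j := by
  have h : max 0 (min u 1) ≤ 1 := max_le zero_le_one (min_le_right _ _)
  rw [ballRadius, mul_comm]
  exact mul_le_mul_of_nonneg_right (by linarith) (by positivity)

/-- A point rescaled so that the cells of level `j` have unit side. -/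
noncomputable def rescale (j : ℤ) (x : EuclideanSpace ℝ (Fin d)) : EuclideanSpace ℝ (Fin d) :=
  (√(d : ℝ) / 2 ^ j) • x

theorem dist_rescale (j : ℤ) (x y : EuclideanSpace ℝ (Fin d)) :
    dist (rescale j x) (rescale j y) = √(d : ℝ) / 2 ^ j * dist x y := by
  rw [rescale, rescale, dist_smul₀, Real.norm_eq_abs, abs_of_nonneg (by positivity)]

/-- The points lie in the same cell of level `j`; one of the cells is a ball around `o`. -/
def InSameCell (w : RandomBits d) (o : EuclideanSpace ℝ (Fin d)) (j : ℤ)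
    (x y : EuclideanSpace ℝ (Fin d)) : Prop :=
  (dist x o ≤ ballRadius w.2 j ∧ dist y o ≤ ballRadius w.2 j) ∨
    (ballRadius w.2 j < dist x o ∧ ballRadius w.2 j < dist y o ∧
      SameCell w.1 (rescale j x) (rescale j y))

/-- The points lie in the same cell at all levels from `k` on. -/
def Together (w : RandomBits d) (o : EuclideanSpace ℝ (Fin d)) (k : ℤ)
    (x y : EuclideanSpace ℝ (Fin d)) : Prop := ∀ j, k ≤ j → InSameCell w o j x y

theorem inSameCell_equivalence (w : RandomBits d) (o : EuclideanSpace ℝ (Fin d)) (j : ℤ) :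
    Equivalence (InSameCell w o j) where
  refl x := by
    rcases le_or_gt (dist x o) (ballRadius w.2 j) with h | h
    · exact Or.inl ⟨h, h⟩
    · exact Or.inr ⟨h, h, (sameCell_equivalence w.1).refl _⟩
  symm {x y} h := by
    rcases h with ⟨h1, h2⟩ | ⟨h1, h2, h3⟩
    · exact Or.inl ⟨h2, h1⟩
    · exact Or.inr ⟨h2, h1, (sameCell_equivalence w.1).symm h3⟩
  trans {x y z} h h' := by
    rcases h with ⟨h1, h2⟩ | ⟨h1, h2, h3⟩ <;> rcases h' with ⟨h1', h2'⟩ | ⟨h1', h2', h3'⟩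
    · exact Or.inl ⟨h1, h2'⟩
    · exact absurd h2 (not_le.2 h1')
    · exact absurd h1' (not_le.2 h2)
    · exact Or.inr ⟨h1, h2', (sameCell_equivalence w.1).trans h3 h3'⟩

theorem together_equivalence (w : RandomBits d) (o : EuclideanSpace ℝ (Fin d)) (k : ℤ) :
    Equivalence (Together w o k) where
  refl x j _ := (inSameCell_equivalence w o j).refl x
  symm h j hj := (inSameCell_equivalence w o j).symm (h j hj)
  trans h h' j hj := (inSameCell_equivalence w o j).trans (h j hj) (h' j hj)

theorem Together.mono {w : RandomBits d} {o x y : EuclideanSpace ℝ (Fin d)} {k l : ℤ} (hkl : k ≤ l)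
    (h : Together w o k x y) : Together w o l x y := fun j hj => h j (hkl.trans hj)

theorem InSameCell.dist_le {w : RandomBits d} {o x y : EuclideanSpace ℝ (Fin d)} {j : ℤ}
    (h : InSameCell w o j x y) : dist x y ≤ 4 * 2 ^ j := by
  have hp : (0 : ℝ) < 2 ^ j := by positivity
  rcases h with ⟨h1, h2⟩ | ⟨-, -, h⟩
  · have := dist_triangle_right x y o
    have := ballRadius_le w.2 j
    linarith
  · have h1 := h.dist_le
    rw [dist_rescale] at h1
    rcases Nat.eq_zero_or_pos d with rfl | hd
    · rw [Subsingleton.elim x y, dist_self]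
      positivity
    · have hs : 0 < √(d : ℝ) := Real.sqrt_pos.2 (by exact_mod_cast hd)
      rw [div_mul_eq_mul_div, div_le_iff₀ hp] at h1
      have := le_of_mul_le_mul_left h1 hs
      linarith

theorem Together.dist_le {w : RandomBits d} {o x y : EuclideanSpace ℝ (Fin d)} {k : ℤ}
    (h : Together w o k x y) : dist x y ≤ 4 * 2 ^ k := (h k le_rfl).dist_le

/-- The purpose of the balls: the hierarchy has a single cluster above the scale of the data
although that scale is unknown. -/
theorem together_of_dist_le (w : RandomBits d) {o x y : EuclideanSpace ℝ (Fin d)} {k : ℤ}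
    (hx : dist x o ≤ 2 ^ k) (hy : dist y o ≤ 2 ^ k) : Together w o k x y := by
  intro j hj
  have h : (2 : ℝ) ^ k ≤ 2 ^ j := zpow_le_zpow_right₀ one_le_two hj
  have h' := le_ballRadius w.2 j
  exact Or.inl ⟨hx.trans (h.trans h'), hy.trans (h.trans h')⟩

theorem measurableSet_inSameCell (o : EuclideanSpace ℝ (Fin d)) (j : ℤ)
    (x y : EuclideanSpace ℝ (Fin d)) : MeasurableSet {w : RandomBits d | InSameCell w o j x y} := by
  have hr : Measurable fun w : RandomBits d => ballRadius w.2 j := by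
    unfold ballRadius
    fun_prop
  have hle : ∀ z : EuclideanSpace ℝ (Fin d),
      MeasurableSet {w : RandomBits d | dist z o ≤ ballRadius w.2 j} := fun z =>
    measurableSet_le measurable_const hr
  have hlt : ∀ z : EuclideanSpace ℝ (Fin d),
      MeasurableSet {w : RandomBits d | ballRadius w.2 j < dist z o} := fun z =>
    measurableSet_lt hr measurable_const
  exact ((hle x).inter (hle y)).union ((hlt x).inter ((hlt y).inter
    (measurable_fst (measurableSet_sameCell (rescale j x) (rescale j y)))))

theorem measurableSet_together (o : EuclideanSpace ℝ (Fin d)) (k : ℤ)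
    (x y : EuclideanSpace ℝ (Fin d)) : MeasurableSet {w : RandomBits d | Together w o k x y} := by
  have : {w : RandomBits d | Together w o k x y} =
      ⋂ j : ℤ, ⋂ _ : k ≤ j, {w : RandomBits d | InSameCell w o j x y} := by
    ext w; simp [Together]
  rw [this]
  exact MeasurableSet.iInter fun j => MeasurableSet.iInter fun _ => measurableSet_inSameCell o j x y

theorem unitUniform_clamp_le (a b : ℝ) :
    unitUniform {u | a ≤ max 0 (min u 1) ∧ max 0 (min u 1) < b} ≤ ENNReal.ofReal (b - a) := by
  have hm : MeasurableSet {u : ℝ | a ≤ max 0 (min u 1) ∧ max 0 (min u 1) < b} :=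
    (measurableSet_le (f := fun _ : ℝ => a) (g := fun u : ℝ => max 0 (min u 1))
      (by fun_prop) (by fun_prop)).inter
      (measurableSet_lt (f := fun u : ℝ => max 0 (min u 1)) (g := fun _ : ℝ => b)
        (by fun_prop) (by fun_prop))
  rw [unitUniform, Measure.restrict_apply hm]
  calc _ ≤ volume (Set.Ico a b) := by
        refine measure_mono fun u hu => ?_
        obtain ⟨⟨h1, h2⟩, h3, h4⟩ := hu
        rw [min_eq_left h4, max_eq_right h3.le] at h1 h2
        exact ⟨h1, h2⟩
    _ = _ := by simp

theorem one_le_sqrt_of_ne {x y : EuclideanSpace ℝ (Fin d)} (hxy : x ≠ y) : 1 ≤ √(d : ℝ) := by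
  rcases Nat.eq_zero_or_pos d with rfl | hd
  · exact absurd (Subsingleton.elim x y) hxy
  · exact Real.one_le_sqrt.2 (by exact_mod_cast hd)

/-- Either the seeds separate the rescaled points, which costs 3π√d·dist/2^j with 3π ≤ 10, or the
radius falls between the two distances to `o`, which costs at most dist/2^j. -/
theorem bitsMeasure_not_inSameCell_le (o : EuclideanSpace ℝ (Fin d)) (j : ℤ)
    (x y : EuclideanSpace ℝ (Fin d)) :
    bitsMeasure d {w | ¬ InSameCell w o j x y} ≤ ENNReal.ofReal (11 * √(d : ℝ) * dist x y / 2 ^ j) := by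
  by_cases hxy : x = y
  · have : {w | ¬ InSameCell w o j x y} = ∅ := Set.eq_empty_of_forall_notMem fun w h =>
      h (hxy ▸ (inSameCell_equivalence w o j).refl x)
    rw [this]; simp
  have hp : (0 : ℝ) < 2 ^ j := by positivity
  set A : Set (ℕ → (Fin d → ℝ) × ℝ) := {w | ¬ SameCell w (rescale j x) (rescale j y)}
  set α := min (dist x o) (dist y o) / 2 ^ j - 1 with hα
  set β := max (dist x o) (dist y o) / 2 ^ j - 1 with hβ
  set U : Set ℝ := {u | α ≤ max 0 (min u 1) ∧ max 0 (min u 1) < β}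
  have hsub : {w | ¬ InSameCell w o j x y} ⊆ A ×ˢ Set.univ ∪ Set.univ ×ˢ U := by
    rintro ⟨w, u⟩ hw
    by_cases hA : w ∈ A
    · exact Or.inl ⟨hA, trivial⟩
    right
    refine ⟨trivial, ?_⟩
    have hA' : SameCell w (rescale j x) (rescale j y) := not_not.1 hA
    change ¬ ((dist x o ≤ ballRadius u j ∧ dist y o ≤ ballRadius u j) ∨
      (ballRadius u j < dist x o ∧ ballRadius u j < dist y o ∧ _)) at hw
    have key : min (dist x o) (dist y o) ≤ ballRadius u j ∧
        ballRadius u j < max (dist x o) (dist y o) := by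
      rw [min_le_iff, lt_max_iff]
      by_contra hcon
      apply hw
      rcases le_or_gt (dist x o) (ballRadius u j) with h1 | h1 <;>
        rcases le_or_gt (dist y o) (ballRadius u j) with h2 | h2
      · exact Or.inl ⟨h1, h2⟩
      · exact absurd ⟨Or.inl h1, Or.inr h2⟩ hcon
      · exact absurd ⟨Or.inr h2, Or.inl h1⟩ hcon
      · exact Or.inr ⟨h1, h2, hA'⟩
    rw [ballRadius] at key
    constructor
    · rw [hα, sub_le_iff_le_add, div_le_iff₀ hp]
      linarith [key.1]
    · rw [hβ, lt_sub_iff_add_lt, lt_div_iff₀ hp]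
      linarith [key.2]
  calc bitsMeasure d {w | ¬ InSameCell w o j x y}
      ≤ bitsMeasure d (A ×ˢ Set.univ) + bitsMeasure d (Set.univ ×ˢ U) :=
        (measure_mono hsub).trans (measure_union_le _ _)
    _ = seedsMeasure d A + unitUniform U := by
        rw [bitsMeasure, Measure.prod_prod, Measure.prod_prod, measure_univ, measure_univ, mul_one,
          one_mul]
    _ ≤ ENNReal.ofReal (3 * Real.pi * dist (rescale j x) (rescale j y)) + ENNReal.ofReal (β - α) :=
        add_le_add (seedsMeasure_not_sameCell_le _ _) (unitUniform_clamp_le _ _)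
    _ = ENNReal.ofReal (3 * Real.pi * dist (rescale j x) (rescale j y) + (β - α)) := by
        refine (ENNReal.ofReal_add (by positivity) ?_).symm
        rw [hα, hβ, sub_sub_sub_cancel_right, ← sub_div]
        exact div_nonneg (sub_nonneg.2 min_le_max) hp.le
    _ ≤ _ := by
        refine ENNReal.ofReal_le_ofReal ?_
        have h1 := one_le_sqrt_of_ne hxy
        have h2 : max (dist x o) (dist y o) - min (dist x o) (dist y o) ≤ dist x y := by
          rw [max_sub_min_eq_abs, abs_sub_comm]
          exact abs_dist_sub_le x y o
        have h3 : β - α ≤ dist x y / 2 ^ j := by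
          rw [hα, hβ, sub_sub_sub_cancel_right, ← sub_div]
          exact div_le_div_of_nonneg_right h2 hp.le
        have h4 : dist x y / 2 ^ j ≤ √(d : ℝ) * (dist x y / 2 ^ j) :=
          le_mul_of_one_le_left (by positivity) h1
        have h5 : 3 * Real.pi * (√(d : ℝ) * (dist x y / 2 ^ j)) ≤
            10 * (√(d : ℝ) * (dist x y / 2 ^ j)) :=
          mul_le_mul_of_nonneg_right (by linarith [Real.pi_lt_d2]) (by positivity)
        rw [dist_rescale]
        have e1 : √(d : ℝ) / 2 ^ j * dist x y = √(d : ℝ) * (dist x y / 2 ^ j) := by ring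
        have e2 : 11 * √(d : ℝ) * dist x y / 2 ^ j = 11 * (√(d : ℝ) * (dist x y / 2 ^ j)) := by ring
        rw [e1, e2]
        linarith

/-- A union bound over the levels from `k` on; the geometric series doubles 11 to 22. Independence
of the levels is not needed, so all of them share the same seeds and radius parameter. -/
theorem bitsMeasure_not_together_le (o : EuclideanSpace ℝ (Fin d)) (k : ℤ)
    (x y : EuclideanSpace ℝ (Fin d)) :
    bitsMeasure d {w | ¬ Together w o k x y} ≤
      ENNReal.ofReal (22 * √(d : ℝ) * dist x y / 2 ^ k) := by
  have hsub : {w | ¬ Together w o k x y} ⊆ ⋃ i : ℕ, {w | ¬ InSameCell w o (k + i) x y} := by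
    intro w hw
    change ¬ ∀ j, k ≤ j → InSameCell w o j x y at hw
    push Not at hw
    obtain ⟨j, hj, hn⟩ := hw
    refine Set.mem_iUnion.2 ⟨(j - k).toNat, ?_⟩
    have : k + ((j - k).toNat : ℤ) = j := by omega
    rw [this]
    exact hn
  set c := 11 * √(d : ℝ) * dist x y / 2 ^ k with hc
  calc bitsMeasure d {w | ¬ Together w o k x y}
      ≤ ∑' i : ℕ, bitsMeasure d {w | ¬ InSameCell w o (k + i) x y} :=
        (measure_mono hsub).trans (measure_iUnion_le _)
    _ ≤ ∑' i : ℕ, ENNReal.ofReal c * 2⁻¹ ^ i := by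
        refine ENNReal.tsum_le_tsum fun i => (bitsMeasure_not_inSameCell_le o _ x y).trans (le_of_eq ?_)
        have h2 : (2⁻¹ : ENNReal) ^ i = ENNReal.ofReal ((2 : ℝ)⁻¹ ^ i) := by
          rw [ENNReal.ofReal_pow (by norm_num), ENNReal.ofReal_inv_of_pos two_pos]
          norm_num
        rw [h2, ← ENNReal.ofReal_mul (by positivity), hc, zpow_add₀ two_ne_zero, zpow_natCast]
        congr 1
        rw [inv_pow]
        field_simp
    _ = ENNReal.ofReal c * 2 := by
        rw [ENNReal.tsum_mul_left, ENNReal.tsum_geometric, ENNReal.one_sub_inv_two, inv_inv]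
    _ = _ := by
        have h2 : ENNReal.ofReal c * 2 = ENNReal.ofReal (c * 2) := by
          rw [ENNReal.ofReal_mul (by positivity), ENNReal.ofReal_ofNat]
        rw [h2, hc]
        congr 1
        ring

open Classical in
/-- The first level at which two different points are together. -/
noncomputable def joinLevel (w : RandomBits d) (o x y : EuclideanSpace ℝ (Fin d)) : ℤ :=
  if x = y then 0 else sInf {k | Together w o k x y}

/-- The infimum is attained: the balls make the set of levels nonempty, and being together at level
k forces distance ≤ 4·2^k, which bounds it below for different points. -/
theorem joinLevel_le_iff (w : RandomBits d) {o x y : EuclideanSpace ℝ (Fin d)} (hxy : x ≠ y)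
    {k : ℤ} : joinLevel w o x y ≤ k ↔ Together w o k x y := by
  have hne : {k | Together w o k x y}.Nonempty := by
    obtain ⟨m, hm⟩ := pow_unbounded_of_one_lt (max (dist x o) (dist y o)) one_lt_two
    refine ⟨m, together_of_dist_le (k := (m : ℤ)) (o := o) (x := x) (y := y) w ?_ ?_⟩ <;>
      rw [zpow_natCast]
    · exact (le_max_left _ _).trans hm.le
    · exact (le_max_right _ _).trans hm.le
  have hbdd : BddBelow {k | Together w o k x y} := by
    obtain ⟨m, hm⟩ := exists_pow_lt_of_lt_one (div_pos (dist_pos.2 hxy) four_pos)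
      (by norm_num : (2 : ℝ)⁻¹ < 1)
    refine ⟨-m, fun k hk => ?_⟩
    by_contra hlt
    push Not at hlt
    have h1 := (Together.mono hlt.le hk).dist_le
    rw [zpow_neg, zpow_natCast, ← inv_pow] at h1
    linarith
  rw [joinLevel, if_neg hxy]
  constructor
  · exact fun h => Together.mono h (Int.csInf_mem hne hbdd)
  · exact fun h => csInf_le hbdd h

theorem measurable_joinLevel (o x y : EuclideanSpace ℝ (Fin d)) :
    Measurable fun w : RandomBits d => joinLevel w o x y := by
  by_cases hxy : x = y
  · simp only [joinLevel, hxy, if_true]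
    exact measurable_const
  · refine measurable_of_Iic fun k => ?_
    have : (fun w : RandomBits d => joinLevel w o x y) ⁻¹' Set.Iic k =
        {w | Together w o k x y} := by
      ext w
      exact joinLevel_le_iff w hxy
    rw [this]
    exact measurableSet_together o k x y

/-- The join levels of the points of a sequence, with its first point as the centre. -/
noncomputable def joinLevels (w : RandomBits d) (x : ℕ → EuclideanSpace ℝ (Fin d)) (i j : ℕ) : ℤ :=
  joinLevel w (x 0) (x i) (x j)

/-- The hierarchy of clusters of the points of a sequence. -/
def pointHierarchy (w : RandomBits d) (x : ℕ → EuclideanSpace ℝ (Fin d)) (k : ℤ) (i j : ℕ) : Prop :=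
  Together w (x 0) k (x i) (x j)

theorem isHierarchy_pointHierarchy (w : RandomBits d) (x : ℕ → EuclideanSpace ℝ (Fin d)) :
    IsHierarchy (pointHierarchy w x) where
  equiv k := (together_equivalence w (x 0) k).comap x
  mono hkl h := Together.mono hkl h

theorem levelRel_joinLevels_iff (w : RandomBits d) {x : ℕ → EuclideanSpace ℝ (Fin d)} {N : ℕ}
    (hx : Set.InjOn x (Set.Iio N)) (k : ℤ) (i j : ℕ) (hi : i < N) (hj : j < N) :
    levelRel (joinLevels w x) k i j ↔ pointHierarchy w x k i j := by
  by_cases hij : i = j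
  · subst hij
    exact ⟨fun _ => (together_equivalence w (x 0) k).refl _, fun _ => Or.inl rfl⟩
  · have hne : x i ≠ x j := fun h => hij (hx hi hj h)
    rw [levelRel, joinLevels, joinLevel_le_iff w hne, pointHierarchy]
    exact or_iff_right hij

/-! ### The randomized online algorithm -/

/-- A finite sequence of points, continued by the origin. -/
noncomputable def extendPoints {N : ℕ} (p : Fin N → EuclideanSpace ℝ (Fin d)) (k : ℕ) :
    EuclideanSpace ℝ (Fin d) := if h : k < N then p ⟨k, h⟩ else 0

theorem extendPoints_restrict {N k : ℕ} (x : ℕ → EuclideanSpace ℝ (Fin d)) (hk : k < N) :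
    extendPoints (fun i : Fin N => x i) k = x k := by
  simp [extendPoints, hk]

theorem measurableSet_balancedRun_joinLevels (x : ℕ → EuclideanSpace ℝ (Fin d)) (n : ℕ)
    (M : Finset (Sym2 ℕ)) :
    MeasurableSet {w : RandomBits d | balancedRun (joinLevels w x) n = M} := by
  classical
  set g : RandomBits d → Fin (2 * n) → Fin (2 * n) → ℤ := fun w i j => joinLevels w x i j with hg
  have hgm : Measurable g := measurable_pi_lambda _ fun i => measurable_pi_lambda _ fun j =>
    measurable_joinLevel _ _ _
  set G : (Fin (2 * n) → Fin (2 * n) → ℤ) → Finset (Sym2 ℕ) := fun t =>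
    balancedRun (fun i j => if h : i < 2 * n ∧ j < 2 * n then t ⟨i, h.1⟩ ⟨j, h.2⟩ else 0) n with hG
  have : {w : RandomBits d | balancedRun (joinLevels w x) n = M} = g ⁻¹' (G ⁻¹' {M}) := by
    ext w
    have : G (g w) = balancedRun (joinLevels w x) n :=
      balancedRun_congr n fun i j hi hj => by simp [hg, hi, hj]
    simp [this]
  rw [this]
  -- Finite matrices of integers form a countable space, so every set of them is measurable.
  exact hgm (Set.to_countable _).measurableSet

/-- Balanced matchings on the clusters of a random hierarchy. -/
noncomputable def hierarchicalMatching (d : ℕ) :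
    RandomizedOnlineMatching (EuclideanSpace ℝ (Fin d)) where
  Ω := RandomBits d
  μ := bitsMeasure d
  output w n p := balancedRun (joinLevels w (extendPoints p)) n
  isPerfectMatching _ n _ := isPerfectMatching_balancedRun _ n
  measurableSet_output n _ M := measurableSet_balancedRun_joinLevels _ n M

theorem hierarchicalMatching_matching (w : RandomBits d) (x : ℕ → EuclideanSpace ℝ (Fin d))
    (n : ℕ) : (hierarchicalMatching d).matching w x n = balancedRun (joinLevels w x) n := by
  refine balancedRun_congr n fun i j hi hj => ?_
  rw [joinLevels, joinLevels, extendPoints_restrict x hi, extendPoints_restrict x hj,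
    extendPoints_restrict x (by omega)]

open Classical in
theorem hierarchicalMatching_expectedWeight_le {x : ℕ → EuclideanSpace ℝ (Fin d)} {n : ℕ}
    (hx : Set.InjOn x (Set.Iio (2 * n))) {k₀ k₁ : ℤ} (hk : k₀ ≤ k₁)
    (h₀ : ∀ w : RandomBits d, ∀ i j, i < 2 * n → j < 2 * n → i ≠ j → ¬ pointHierarchy w x k₀ i j)
    (h₁ : ∀ w : RandomBits d, ∀ i j, i < 2 * n → j < 2 * n → pointHierarchy w x k₁ i j)
    {M' : Finset (Sym2 ℕ)} (hM' : IsPerfectMatching n M') :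
    (hierarchicalMatching d).expectedWeight x n ≤
      352 * √(d : ℝ) * (k₁ - k₀) * weight x M' := by
  have hms : ∀ (k : ℤ) (e : Sym2 ℕ), MeasurableSet {w | Splits (pointHierarchy w x) k e} ∧
      (bitsMeasure d).real {w | Splits (pointHierarchy w x) k e} ≤
        22 * √(d : ℝ) * edgeLength x e / 2 ^ k := by
    intro k e
    induction e using Sym2.ind with
    | _ a b =>
      have : {w | Splits (pointHierarchy w x) k s(a, b)} =
          {w | ¬ Together w (x 0) k (x a) (x b)} := by
        ext w
        exact (isHierarchy_pointHierarchy w x).splits_mk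
      rw [this]
      refine ⟨(measurableSet_together (x 0) k (x a) (x b)).compl, ?_⟩
      refine ENNReal.toReal_le_of_le_ofReal ?_ (bitsMeasure_not_together_le _ _ _ _)
      have : 0 ≤ edgeLength x s(a, b) := dist_nonneg (x := x a) (y := x b)
      positivity
  have hcard : ∀ (k : ℤ) (w : RandomBits d),
      ((M'.filter (Splits (pointHierarchy w x) k)).card : ℝ) =
        ∑ e ∈ M', Set.indicator {w | Splits (pointHierarchy w x) k e} (fun _ => (1 : ℝ)) w := by
    intro k w
    rw [Finset.card_filter, Nat.cast_sum]
    refine Finset.sum_congr rfl fun e _ => ?_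
    simp [Set.indicator_apply]
  have hint : ∀ (k : ℤ) (e : Sym2 ℕ), Integrable
      (Set.indicator {w | Splits (pointHierarchy w x) k e} (fun _ => (1 : ℝ))) (bitsMeasure d) :=
    fun k e => (integrable_const 1).indicator (hms k e).1
  have hint' : ∀ k : ℤ, Integrable (fun w => 16 * (2 : ℝ) ^ k *
      ∑ e ∈ M', Set.indicator {w | Splits (pointHierarchy w x) k e} (fun _ => (1 : ℝ)) w)
      (bitsMeasure d) :=
    fun k => (integrable_finsetSum _ fun e _ => hint k e).const_mul _
  have hnn : ∀ (M : Finset (Sym2 ℕ)), 0 ≤ weight x M := fun M => Finset.sum_nonneg fun e _ => by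
    induction e using Sym2.ind with
    | _ a b => exact dist_nonneg (x := x a) (y := x b)
  change ∫ w, weight x ((hierarchicalMatching d).matching w x n) ∂bitsMeasure d ≤ _
  calc ∫ w, weight x ((hierarchicalMatching d).matching w x n) ∂bitsMeasure d
      ≤ ∫ w, ∑ k ∈ Finset.Ico k₀ k₁, 16 * (2 : ℝ) ^ k *
        ∑ e ∈ M', Set.indicator {w | Splits (pointHierarchy w x) k e} (fun _ => (1 : ℝ)) w
        ∂bitsMeasure d := by
        refine integral_mono_of_nonneg (Filter.Eventually.of_forall fun w => hnn _)
          (integrable_finsetSum _ fun k _ => hint' k) (Filter.Eventually.of_forall fun w => ?_)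
        simp_rw [← hcard]
        rw [hierarchicalMatching_matching]
        have hH := isHierarchy_pointHierarchy w x
        exact hH.weight_le (isPerfectMatching_balancedRun _ n) hM'
          (hH.isBalancedMatching_balancedRun (levelRel_joinLevels_iff w hx) (h₀ w) (h₁ w))
          (h₀ w) (h₁ w) fun k i j h => Together.dist_le h
    _ = ∑ k ∈ Finset.Ico k₀ k₁, 16 * (2 : ℝ) ^ k *
        ∑ e ∈ M', (bitsMeasure d).real {w | Splits (pointHierarchy w x) k e} := by
        rw [integral_finsetSum _ fun k _ => hint' k]
        refine Finset.sum_congr rfl fun k _ => ?_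
        rw [integral_const_mul, integral_finsetSum _ fun e _ => hint k e]
        refine congrArg _ (Finset.sum_congr rfl fun e _ => ?_)
        exact integral_indicator_one (hms k e).1
    -- The factor 2^k cancels against the separation probability, so all levels contribute equally;
    -- 352 = 16·22.
    _ ≤ ∑ k ∈ Finset.Ico k₀ k₁, 352 * √(d : ℝ) * weight x M' := by
        refine Finset.sum_le_sum fun k _ => ?_
        have hp : (0 : ℝ) < 2 ^ k := by positivity
        calc 16 * (2 : ℝ) ^ k * ∑ e ∈ M', (bitsMeasure d).real {w | Splits (pointHierarchy w x) k e}
            ≤ 16 * (2 : ℝ) ^ k * ∑ e ∈ M', 22 * √(d : ℝ) * edgeLength x e / 2 ^ k :=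
              mul_le_mul_of_nonneg_left (Finset.sum_le_sum fun e _ => (hms k e).2) (by positivity)
          _ = 352 * √(d : ℝ) * weight x M' := by
              rw [weight, ← Finset.sum_div, ← Finset.mul_sum]
              field_simp
              ring
    _ = _ := by
        rw [Finset.sum_const, Int.card_Ico, nsmul_eq_mul]
        have : (((k₁ - k₀).toNat : ℕ) : ℝ) = k₁ - k₀ := by
          rw [← Int.cast_natCast, Int.toNat_of_nonneg (by omega), Int.cast_sub]
        rw [this]
        ring

end

section

variable {d : ℕ}

/-! ### The aspect ratio bounds the number of levels -/

/-- The levels of the hierarchy that matter are between those of the least and the largest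
distance. -/
theorem exists_level_range {x : ℕ → EuclideanSpace ℝ (Fin d)} {n : ℕ} (hn : 1 ≤ n)
    (hx : Set.InjOn x (Set.Iio (2 * n))) :
    0 ≤ Real.log (aspectRatio x (2 * n)) ∧ ∃ k₀ k₁ : ℤ, k₀ ≤ k₁ ∧
      ((k₁ - k₀ : ℤ) : ℝ) ≤ 5 * (1 + Real.log (aspectRatio x (2 * n))) ∧
      (∀ w : RandomBits d, ∀ i j, i < 2 * n → j < 2 * n → i ≠ j → ¬ pointHierarchy w x k₀ i j) ∧
      ∀ w : RandomBits d, ∀ i j, i < 2 * n → j < 2 * n → pointHierarchy w x k₁ i j := by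
  set D := ⨆ p : Fin (2 * n) × Fin (2 * n), dist (x p.1) (x p.2) with hD
  set δ := ⨅ p : {p : Fin (2 * n) × Fin (2 * n) // p.1 ≠ p.2}, dist (x p.1.1) (x p.1.2) with hδ
  have hΦ : aspectRatio x (2 * n) = D / δ := rfl
  have hdD : ∀ i j, i < 2 * n → j < 2 * n → dist (x i) (x j) ≤ D := fun i j hi hj =>
    le_ciSup (f := fun p : Fin (2 * n) × Fin (2 * n) => dist (x p.1) (x p.2))
      (Set.finite_range _).bddAbove (⟨i, hi⟩, ⟨j, hj⟩)
  have hdδ : ∀ i j, i < 2 * n → j < 2 * n → i ≠ j → δ ≤ dist (x i) (x j) := fun i j hi hj hij =>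
    ciInf_le (f := fun p : {p : Fin (2 * n) × Fin (2 * n) // p.1 ≠ p.2} =>
      dist (x p.1.1) (x p.1.2)) (Set.finite_range _).bddBelow
      ⟨(⟨i, hi⟩, ⟨j, hj⟩), fun h => hij (Fin.mk.inj_iff.1 h)⟩
  have hδ0 : 0 < δ := by
    have : Nonempty {p : Fin (2 * n) × Fin (2 * n) // p.1 ≠ p.2} :=
      ⟨⟨(⟨0, by omega⟩, ⟨1, by omega⟩), fun h => zero_ne_one (Fin.mk.inj_iff.1 h)⟩⟩
    obtain ⟨⟨⟨i, j⟩, hij⟩, hp⟩ := exists_eq_ciInf_of_finite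
      (f := fun p : {p : Fin (2 * n) × Fin (2 * n) // p.1 ≠ p.2} => dist (x p.1.1) (x p.1.2))
    rw [hδ, ← hp]
    exact dist_pos.2 fun h => hij (Fin.ext (hx i.2 j.2 h))
  have hδD : δ ≤ D := (hdδ 0 1 (by omega) (by omega) zero_ne_one).trans
    (hdD 0 1 (by omega) (by omega))
  have hD0 : 0 < D := hδ0.trans_le hδD
  have hlog : 0 ≤ Real.log (D / δ) := Real.log_nonneg ((one_le_div hδ0).2 hδD)
  have hl2 : 1 / 2 ≤ Real.log 2 := by linarith [Real.log_two_gt_d9]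
  have hlb : Real.logb 2 D - Real.logb 2 δ ≤ 2 * Real.log (D / δ) := by
    rw [← Real.logb_div hD0.ne' hδ0.ne', Real.logb, div_le_iff₀ (by linarith)]
    nlinarith
  have hlb0 : Real.logb 2 δ ≤ Real.logb 2 D := Real.logb_le_logb_of_le one_lt_two hδ0 hδD
  have h1 := Int.le_ceil (Real.logb 2 D)
  have h2 := Int.ceil_lt_add_one (Real.logb 2 D)
  have h3 := Int.floor_le (Real.logb 2 δ)
  have h4 := Int.lt_floor_add_one (Real.logb 2 δ)
  rw [hΦ]
  -- The shift by 3 turns the diameter bound 4·2^k₀ into at most δ/2. Together with the two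
  -- roundings it accounts for the 5.
  refine ⟨hlog, ⌊Real.logb 2 δ⌋ - 3, ⌈Real.logb 2 D⌉, ?_, ?_, ?_, ?_⟩
  · have : (⌊Real.logb 2 δ⌋ : ℝ) ≤ ⌈Real.logb 2 D⌉ := by linarith
    have : ⌊Real.logb 2 δ⌋ ≤ ⌈Real.logb 2 D⌉ := by exact_mod_cast this
    omega
  · push_cast
    linarith
  · intro w i j hi hj hij h
    have h5 := Together.dist_le h
    have h6 := hdδ i j hi hj hij
    have h7 : (2 : ℝ) ^ ⌊Real.logb 2 δ⌋ ≤ δ := by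
      rw [← Real.rpow_intCast]
      exact (Real.rpow_le_rpow_of_exponent_le one_le_two h3).trans
        (Real.rpow_logb two_pos (by norm_num) hδ0).le
    rw [zpow_sub₀ two_ne_zero] at h5
    norm_num at h5
    linarith
  · intro w i j hi hj
    have h7 : D ≤ (2 : ℝ) ^ ⌈Real.logb 2 D⌉ := by
      rw [← Real.rpow_intCast]
      exact (Real.rpow_logb two_pos (by norm_num) hD0).ge.trans
        (Real.rpow_le_rpow_of_exponent_le one_le_two h1)
    exact together_of_dist_le w ((hdD i 0 hi (by omega)).trans h7)
      ((hdD j 0 hj (by omega)).trans h7)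

theorem hierarchicalMatching_expectedWeight_le_optWeight {x : ℕ → EuclideanSpace ℝ (Fin d)} {n : ℕ}
    (hn : 1 ≤ n) (hx : Set.InjOn x (Set.Iio (2 * n))) :
    (hierarchicalMatching d).expectedWeight x n ≤
      2000 * √(d : ℝ) * (1 + Real.log (aspectRatio x (2 * n))) * optWeight x n := by
  obtain ⟨hlog, k₀, k₁, hk, hkk, h₀, h₁⟩ := exists_level_range hn hx
  have hd : 1 ≤ √(d : ℝ) := one_le_sqrt_of_ne (x := x 0) (y := x 1) fun h =>
    zero_ne_one (hx (show 0 < 2 * n by omega) (show 1 < 2 * n by omega) h)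
  set L := Real.log (aspectRatio x (2 * n))
  have hK : 0 < 2000 * √(d : ℝ) * (1 + L) := by positivity
  rw [← div_le_iff₀' hK, optWeight]
  refine le_csInf ⟨_, _, isPerfectMatching_balancedRun (fun _ _ => 0) n, rfl⟩ ?_
  rintro _ ⟨M', hM', rfl⟩
  rw [div_le_iff₀' hK]
  refine (hierarchicalMatching_expectedWeight_le hx hk h₀ h₁ hM').trans ?_
  have hw : 0 ≤ weight x M' := Finset.sum_nonneg fun e _ => by
    induction e using Sym2.ind with
    | _ a b => exact dist_nonneg (x := x a) (y := x b)
  refine mul_le_mul_of_nonneg_right ?_ hw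
  -- The constant 2000 exceeds 352·5.
  push_cast at hkk
  nlinarith

theorem hierarchicalMatching_recourse_le {x : ℕ → EuclideanSpace ℝ (Fin d)} {n : ℕ}
    (hn : 1 ≤ n) (hx : Set.InjOn x (Set.Iio (2 * n))) (w : RandomBits d) :
    ((hierarchicalMatching d).recourse w x n : ℝ) ≤
        2000 * (1 + Real.log (aspectRatio x (2 * n))) ∧
      ((hierarchicalMatching d).recourse w x n : ℝ) ≤ 2000 * Real.log n ^ 3 := by
  obtain ⟨hlog, k₀, k₁, hk, hkk, h₀, h₁⟩ := exists_level_range hn hx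
  obtain ⟨m, rfl⟩ : ∃ m, n = m + 1 := ⟨n - 1, by omega⟩
  have hrec : (hierarchicalMatching d).recourse w x (m + 1) =
      (balancedRun (joinLevels w x) m \ balancedRun (joinLevels w x) (m + 1)).card := by
    rw [← hierarchicalMatching_matching, ← hierarchicalMatching_matching]
    rfl
  rw [hrec]
  have hH := isHierarchy_pointHierarchy w x
  have hag := levelRel_joinLevels_iff w hx
  constructor
  · have h1 := hH.card_balancedRun_sdiff_le_depth hag (h₀ w) (h₁ w)
    have h2 : (((k₁ - k₀).toNat : ℕ) : ℝ) = ((k₁ - k₀ : ℤ) : ℝ) := by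
      rw [← Int.cast_natCast, Int.toNat_of_nonneg (by omega)]
    have h3 : ((balancedRun (joinLevels w x) m \ balancedRun (joinLevels w x) (m + 1)).card : ℝ) ≤
        12 * (((k₁ - k₀).toNat : ℕ) : ℝ) := by exact_mod_cast h1
    rw [h2] at h3
    linarith
  -- For the first pair log³ n = 0, but there is no edge to delete.
  · rcases Nat.eq_zero_or_pos m with rfl | hm
    · simp [balancedRun]
    have h1 := hH.card_balancedRun_sdiff_le_log hag (h₀ w) (h₁ w)
    have hm' : (1 : ℝ) ≤ m := by exact_mod_cast hm
    push_cast
    have h2 : Real.log (2 * ((m : ℝ) + 1)) = Real.log 2 + Real.log (m + 1) :=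
      Real.log_mul two_ne_zero (by positivity)
    have h3 : Real.log 2 ≤ Real.log ((m : ℝ) + 1) := Real.log_le_log two_pos (by linarith)
    have h4 : 1 / 2 ≤ Real.log 2 := by linarith [Real.log_two_gt_d9]
    set l := Real.log ((m : ℝ) + 1)
    -- Only here is log n weakened to log³ n; it uses l ≥ log 2 ≥ 1/2.
    have h5 : l ≤ 4 * l ^ 3 := by nlinarith [sq_nonneg l, mul_self_nonneg (l - 1 / 2)]
    rw [h2] at h1
    linarith

end

/-! ### Both parts from one algorithm. -/

theorem mainTheorem7 :
    ∃ C : ℝ, 0 < C ∧ ∀ d : ℕ,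
      (∃ A : RandomizedOnlineMatching (EuclideanSpace ℝ (Fin d)),
        ∀ (x : ℕ → EuclideanSpace ℝ (Fin d)) (n : ℕ), 1 ≤ n → Set.InjOn x (Set.Iio (2 * n)) →
          A.expectedWeight x n ≤
            C * √(d : ℝ) * (1 + Real.log (aspectRatio x (2 * n))) * optWeight x n ∧
          ∀ ω : A.Ω, (A.recourse ω x n : ℝ) ≤ C * (1 + Real.log (aspectRatio x (2 * n)))) ∧
      (∃ A : RandomizedOnlineMatching (EuclideanSpace ℝ (Fin d)),
        ∀ (x : ℕ → EuclideanSpace ℝ (Fin d)) (n : ℕ), 1 ≤ n → Set.InjOn x (Set.Iio (2 * n)) →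
          A.expectedWeight x n ≤
            C * √(d : ℝ) * (1 + Real.log (aspectRatio x (2 * n))) * optWeight x n ∧
          ∀ ω : A.Ω, (A.recourse ω x n : ℝ) ≤ C * Real.log (n : ℝ) ^ 3) := by
  refine ⟨2000, by norm_num, fun d => ⟨⟨hierarchicalMatching d, fun x n hn hx => ?_⟩,
    ⟨hierarchicalMatching d, fun x n hn hx => ?_⟩⟩⟩
  · exact ⟨hierarchicalMatching_expectedWeight_le_optWeight hn hx,
      fun w => (hierarchicalMatching_recourse_le hn hx w).1⟩
  · exact ⟨hierarchicalMatching_expectedWeight_le_optWeight hn hx,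
      fun w => (hierarchicalMatching_recourse_le hn hx w).2⟩
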